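/- **Setting.** Let $\Theta\subset\mathbb R^d$ be compact and, for $\theta\in\Theta$, let $\nu_\theta$ be a probability measure on the set of probability vectors $p=(p(-2),p(-1),p(1))$. Under $\mathbb P^\theta=\nu_\theta^{\otimes\mathbb Z}$ the environment $\omega=(\omega_x)_{x\in\mathbb Z}$ is i.i.d. with marginal $\nu_\theta$. Given $\omega$, let $P_\omega$ be the law of the Markov chain $(X_t)_{t\ge0}$ on $\mathbb Z$ with $X_0=0$ and $P_\omega(X_{t+1}=x+l\mid X_t=x)=\omega_x(l)$ for $l=-2,-1,1$. Put $a_k=\omega_k(-1)/\omega_k(1)$, $b_k=\omega_k(-2)/\omega_k(1)$ and $$A_k=\begin{pmatrix}a_k&b_k&0\\a_k&b_k&1\\a_k&b_k&0\end{pmatrix}.$$ Assume * (C1) $\inf_{\theta\in\Theta}\mathbb E^\theta[\log\omega_0(l)]>-\infty$ for $l=-2,-1,1$ (with $\log 0=-\infty$); * (C2) for every $\theta\in\Theta$ the top Lyapunov exponent $\gamma_A=\lim_{n\to\infty}\frac1n\mathbb E^\theta\log\|A_0A_1\cdots A_{n-1}\|$ is negative. For $n\ge1$ let $T_n=\inf\{t>0:X_t=n\}$,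 and for $i\in\mathbb Z$ let $\mathbf U^n_i=(U^n_{i,1},U^n_{i,2},U^n_{i,3})$ be the vector of the numbers of times $k$ with $0<k<T_n$ at which $(X_{k-1},X_k)$ equals $(i,i-1)$, $(i,i-2)$, $(i+1,i-1)$, respectively. **Theorem.** Let $\theta\in\Theta$. For $\mathbb P^\theta$-almost every $\omega$ and every $n\ge1$ the following hold. 1. $\mathbf U^n_n=0$ $P_\omega$-almost surely, and under $P_\omega$ the sequence $(\mathbf U^n_n,\mathbf U^n_{n-1},\dots,\mathbf U^n_0)$ has the same law as the first generations $(Z_0,Z_1,\dots,Z_n)$ of the following $3$-type branching process with immigration: $Z_0=0$; at each time $m=n-(i+1)$, $0\le i\le n-1$, one type-$1$ individual immigrates; then this immigrant and the individuals counted by $Z_m$ independently give birth, and $Z_{m+1}$ is the vector of the total numbers of their children of each type. The numbers of children (of types $1,2,3$) of an individual of type $1$, $2$, $3$ living at time $m=n-(i+1)$ are respectively $(a,b,0)$, $(a,b,1)$, $(a,b,0)$ with probability $$\frac{(a+b)!}{a!\,b!}\,\omega_i(-1)^a\,\omega_i(-2)^b\,\omega_i(1),\qquad a,b\in\{0,1,2,\dots\}.$$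 2. $P_\omega$-almost surely $T_n<\infty$ and $$T_n=n+\sum_{k=-\infty}^{n-1}\mathbf U^n_k\,(2,1,2)^t=n+\sum_{k=-\infty}^{n-1}\bigl(2U^n_{k,1}+U^n_{k,2}+2U^n_{k,3}\bigr).$$ -/

import Mathlib

open MeasureTheory ProbabilityTheory Filter Topology
open scoped Nat

namespace RWRE

/-! ### Environment, quenched walk -/

/-- A probability vector `(p(-2), p(-1), p(1))` on the possible jumps `-2, -1, 1`, stored as the
coordinates `0, 1, 2`. -/
abbrev StepLaw : Type := stdSimplex ℝ (Fin 3)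

/-- The probability `p(l)` of the jump `l`. -/
def prob (p : StepLaw) (l : ℤ) : ℝ :=
  if l = -2 then p 0 else if l = -1 then p 1 else if l = 1 then p 2 else 0

/-- An environment: a jump law at each site of `ℤ`. -/
abbrev Env : Type := ℤ → StepLaw

/-- The law of an i.i.d. environment whose one-site marginal is `ν`. -/
noncomputable def envLaw (ν : Measure StepLaw) [IsProbabilityMeasure ν] : Measure Env :=
  Measure.infinitePi fun _ : ℤ => ν

/-- The law of the position after one step of the walk from `x` in the environment `ω`. -/
noncomputable def stepMeasure (ω : Env) (x : ℤ) : Measure ℤ :=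
  ENNReal.ofReal (prob (ω x) (-2)) • Measure.dirac (x - 2)
    + ENNReal.ofReal (prob (ω x) (-1)) • Measure.dirac (x - 1)
    + ENNReal.ofReal (prob (ω x) 1) • Measure.dirac (x + 1)

theorem prob_nonneg (p : StepLaw) (l : ℤ) : 0 ≤ prob p l := by
  unfold prob
  split_ifs
  · exact p.2.1 0
  · exact p.2.1 1
  · exact p.2.1 2
  · exact le_rfl

theorem prob_sum (p : StepLaw) : prob p (-2) + prob p (-1) + prob p 1 = 1 := by
  have h := p.2.2
  rw [Fin.sum_univ_three] at h
  change p 0 + p 1 + p 2 = 1 at h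
  simpa [prob] using h

instance isProbabilityMeasure_stepMeasure (ω : Env) (x : ℤ) :
    IsProbabilityMeasure (stepMeasure ω x) := by
  constructor
  simp only [stepMeasure, Measure.add_apply, Measure.smul_apply, measure_univ, smul_eq_mul,
    mul_one]
  rw [← ENNReal.ofReal_add (prob_nonneg _ _) (prob_nonneg _ _),
    ← ENNReal.ofReal_add (add_nonneg (prob_nonneg _ _) (prob_nonneg _ _)) (prob_nonneg _ _),
    prob_sum, ENNReal.ofReal_one]

/-- The transition kernel of the walk from its history up to time `t` to its position at time
`t + 1`; it only uses the current position. -/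
noncomputable def stepKernel (ω : Env) (t : ℕ) :
    Kernel ((i : Finset.Iic t) → (fun _ : ℕ => ℤ) i) ℤ :=
  Kernel.ofFunOfCountable fun h => stepMeasure ω (h ⟨t, Finset.mem_Iic.2 le_rfl⟩)

instance isMarkovKernel_stepKernel (ω : Env) (t : ℕ) : IsMarkovKernel (stepKernel ω t) :=
  ⟨fun h => isProbabilityMeasure_stepMeasure ω (h ⟨t, Finset.mem_Iic.2 le_rfl⟩)⟩

/-- The quenched law `P_ω` of the walk `(X_0, X_1, …)` started from `X_0 = 0`: the law of the
Markov chain with the above transitions, on the space of paths. -/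
noncomputable def quenchedLaw (ω : Env) : Measure (ℕ → ℤ) :=
  Kernel.traj (X := fun _ => ℤ) (stepKernel ω) 0 (fun _ => 0)

/-! ### The conditions on the environment -/

/-- `inf_θ E^θ[log ω_0(l)] > -∞` for `l = -2, -1, 1`, with `log 0 = -∞`.  As `log ω_0(l) ≤ 0`,
finiteness of an expectation means that `ω_0(l) > 0` almost surely and `log ω_0(l)` is
integrable. -/
def UniformLogMoment {ι : Type*} (ν : ι → Measure StepLaw) : Prop :=
  ∀ l : ℤ, l = -2 ∨ l = -1 ∨ l = 1 →
    (∀ θ, (∀ᵐ p ∂ν θ, 0 < prob p l) ∧ Integrable (fun p => Real.log (prob p l)) (ν θ)) ∧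
    BddBelow (Set.range fun θ => ∫ p, Real.log (prob p l) ∂ν θ)

/-- The matrix with rows `(a, b, 0)`, `(a, b, 1)`, `(a, b, 0)`, where `a = p(-1) / p(1)` and
`b = p(-2) / p(1)`. -/
noncomputable def meanMatrix (p : StepLaw) : Matrix (Fin 3) (Fin 3) ℝ :=
  !![prob p (-1) / prob p 1, prob p (-2) / prob p 1, 0;
     prob p (-1) / prob p 1, prob p (-2) / prob p 1, 1;
     prob p (-1) / prob p 1, prob p (-2) / prob p 1, 0]

section Lyapunov

attribute [local instance] Matrix.linftyOpNormedAddCommGroup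

/-- The top Lyapunov exponent `lim_n (1/n) E log ‖A_0 A_1 ⋯ A_{n-1}‖` of the i.i.d. matrices
`A_k = meanMatrix ω_k`.  Under the logarithmic moment condition the limit exists by
subadditivity; it is written as a limsup in the extended reals so that it is always defined. -/
noncomputable def topLyapunov (ν : Measure StepLaw) [IsProbabilityMeasure ν] : EReal :=
  limsup (fun n : ℕ =>
    (((∫ ω, Real.log ‖((List.range n).map fun k => meanMatrix (ω (k : ℤ))).prod‖ ∂envLaw ν) / n
      : ℝ) : EReal)) atTop

end Lyapunov

/-! ### Hitting times and jump counts of a path -/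

/-- `T_n = inf {t > 0 : X_t = n}`, with value `⊤` if `n` is never hit. -/
noncomputable def hittingTime (n : ℤ) (X : ℕ → ℤ) : ℕ∞ :=
  ⨅ (t : ℕ) (_ : 0 < t ∧ X t = n), (t : ℕ∞)

/-- `U^n_i`: the numbers of jumps `i → i - 1`, `i → i - 2` and `i + 1 → i - 1` before `T_n`. -/
noncomputable def jumpCount (n i : ℤ) (X : ℕ → ℤ) : Fin 3 → ℕ :=
  ![{k : ℕ | 0 < k ∧ (k : ℕ∞) < hittingTime n X ∧ X (k - 1) = i ∧ X k = i - 1}.ncard,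
    {k : ℕ | 0 < k ∧ (k : ℕ∞) < hittingTime n X ∧ X (k - 1) = i ∧ X k = i - 2}.ncard,
    {k : ℕ | 0 < k ∧ (k : ℕ∞) < hittingTime n X ∧ X (k - 1) = i + 1 ∧ X k = i - 1}.ncard]

/-! ### Offspring laws -/

/-- `(a+b)! / (a! b!) p(-1)^a p(-2)^b p(1)`. -/
noncomputable def pairMass (p : StepLaw) (v : ℕ × ℕ) : ℝ :=
  ((v.1 + v.2)! : ℝ) / ((v.1 ! : ℝ) * (v.2 ! : ℝ))
    * prob p (-1) ^ v.1 * prob p (-2) ^ v.2 * prob p 1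

theorem pairMass_nonneg (p : StepLaw) (v : ℕ × ℕ) : 0 ≤ pairMass p v := by
  have h1 := prob_nonneg p (-1)
  have h2 := prob_nonneg p (-2)
  have h3 := prob_nonneg p 1
  unfold pairMass
  positivity

theorem sum_antidiagonal_pairMass (p : StepLaw) (N : ℕ) :
    ∑ v ∈ Finset.HasAntidiagonal.antidiagonal N, pairMass p v
      = (prob p (-1) + prob p (-2)) ^ N * prob p 1 := by
  rw [(Commute.all (prob p (-1)) (prob p (-2))).add_pow', Finset.sum_mul]
  refine Finset.sum_congr rfl fun v hv => ?_
  have hN : v.1 + v.2 = N := Finset.HasAntidiagonal.mem_antidiagonal.1 hv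
  subst hN
  rw [pairMass, Nat.choose_symm_add, Nat.add_choose, nsmul_eq_mul,
    Nat.cast_div (Nat.factorial_mul_factorial_dvd_factorial_add _ _) (by positivity)]
  push_cast
  ring

theorem hasSum_pairMass (p : StepLaw) (h : 0 < prob p 1) :
    HasSum (fun v => ENNReal.ofReal (pairMass p v)) 1 := by
  have hs := prob_sum p
  have h1 := prob_nonneg p (-1)
  have h2 := prob_nonneg p (-2)
  rw [ENNReal.summable.hasSum_iff,
    ← (Finset.HasAntidiagonal.sigmaAntidiagonalEquivProd (A := ℕ)).tsum_eq, ENNReal.tsum_sigma']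
  have key : ∀ N : ℕ, ∑' v : Finset.HasAntidiagonal.antidiagonal N, ENNReal.ofReal
      (pairMass p (Finset.HasAntidiagonal.sigmaAntidiagonalEquivProd ⟨N, v⟩))
        = ENNReal.ofReal ((prob p (-1) + prob p (-2)) ^ N * prob p 1) := by
    intro N
    rw [tsum_fintype, ← sum_antidiagonal_pairMass,
      ENNReal.ofReal_sum_of_nonneg fun v _ => pairMass_nonneg p v]
    exact Finset.sum_coe_sort (Finset.HasAntidiagonal.antidiagonal N) fun v => ENNReal.ofReal (pairMass p v)
  simp_rw [key]
  have hg : HasSum (fun N : ℕ => (prob p (-1) + prob p (-2)) ^ N * prob p 1) 1 := by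
    have hg := (hasSum_geometric_of_lt_one (r := prob p (-1) + prob p (-2))
      (by linarith) (by linarith)).mul_right (prob p 1)
    have he : (1 - (prob p (-1) + prob p (-2)))⁻¹ * prob p 1 = 1 := by
      rw [show 1 - (prob p (-1) + prob p (-2)) = prob p 1 by linarith]
      exact inv_mul_cancel₀ h.ne'
    rwa [he] at hg
  rw [← ENNReal.ofReal_tsum_of_nonneg (fun N => by positivity) hg.summable, hg.tsum_eq,
    ENNReal.ofReal_one]

open Classical in
/-- The law of the pair `(a, b)` with masses `pairMass p`.  These masses add up to `1` if
`p(1) > 0`; in the excluded case `p(1) = 0` the value is arbitrary. -/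
noncomputable def pairLaw (p : StepLaw) : PMF (ℕ × ℕ) :=
  if h : 0 < prob p 1 then ⟨fun v => ENNReal.ofReal (pairMass p v), hasSum_pairMass p h⟩
  else PMF.pure (0, 0)

/-- The offspring law at a site with jump law `p`: with `(a, b)` drawn from `pairLaw p`, an
individual of the first or third type (indices `0`, `2`) has offspring `(a, b, 0)`, one of the
second type (index `1`) has offspring `(a, b, 1)`. -/
noncomputable def offspringLaw (p : StepLaw) (τ : Fin 3) : PMF (Fin 3 → ℕ) :=
  (pairLaw p).map fun v => ![v.1, v.2, if τ = 1 then 1 else 0]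

/-! ### Three-type branching processes with immigration -/

/-- The generations of a three-type branching process with one immigrant of the first type in
each generation, starting from no individuals: `ξ (m, τ, j)` is the offspring of the `j`-th
individual of type `τ` present at time `m` (immigrant included). -/
def generation (ξ : ℕ × Fin 3 × ℕ → Fin 3 → ℕ) : ℕ → Fin 3 → ℕ
  | 0 => 0
  | m + 1 =>
      (∑ j ∈ Finset.range (1 + generation ξ m 0), ξ (m, 0, j))
        + (∑ j ∈ Finset.range (generation ξ m 1), ξ (m, 1, j))
        + ∑ j ∈ Finset.range (generation ξ m 2), ξ (m, 2, j)

/-- The law of the generations `(Z_0, Z_1, …)` when the `ξ (m, τ, j)` are independent and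
`ξ (m, τ, j)` has law `q m τ`. -/
noncomputable def branchingLaw (q : ℕ → Fin 3 → PMF (Fin 3 → ℕ)) :
    Measure (ℕ → Fin 3 → ℕ) :=
  (Measure.infinitePi fun k : ℕ × Fin 3 × ℕ => (q k.1 k.2.1).toMeasure).map generation

theorem measurable_generation : Measurable generation := by
  refine measurable_pi_lambda _ fun m => ?_
  induction m with
  | zero => exact measurable_const
  | succ m ih =>
    have aux : ∀ (τ : Fin 3) (N : (Fin 3 → ℕ) → ℕ),
        Measurable fun ξ : ℕ × Fin 3 × ℕ → Fin 3 → ℕ =>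
          ∑ j ∈ Finset.range (N (generation ξ m)), ξ (m, τ, j) := by
      intro τ N
      have h : Measurable fun z : (ℕ × Fin 3 × ℕ → Fin 3 → ℕ) × (Fin 3 → ℕ) =>
          ∑ j ∈ Finset.range (N z.2), z.1 (m, τ, j) :=
        measurable_from_prod_countable_left fun v =>
          Finset.measurable_sum (Finset.range (N v)) fun j _ =>
            measurable_pi_apply (X := fun _ : ℕ × Fin 3 × ℕ => Fin 3 → ℕ) (m, τ, j)
      exact h.comp (measurable_id.prodMk ih)
    exact ((aux 0 fun v => 1 + v 0).add (aux 1 fun v => v 1)).add (aux 2 fun v => v 2)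

instance isProbabilityMeasure_branchingLaw (q : ℕ → Fin 3 → PMF (Fin 3 → ℕ)) :
    IsProbabilityMeasure (branchingLaw q) :=
  Measure.isProbabilityMeasure_map measurable_generation.aemeasurable

end RWRE

open RWRE

/-!
When the Lyapunov exponent is negative, the expected passage times `h i` from `i` to `i + 1`, which
satisfy a linear recursion driven by the matrices `A_k`, are finite: they are a convergent series of
matrix products. A Foster–Lyapunov argument with these `h i` shows that the walk reaches every
`n > 0` almost surely.

Two laws of integer vectors agree as soon as their generating functions agree on the unit torus.
Put variables `u i σ` on the jumps counted by `U^n_{i, σ}`. Decomposing the path at the passages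
from `i` to `i + 1` on one side, and the branching process at its generations on the other side,
both generating functions become `∏ F j` over `0 ≤ j < n`, where, with `p = ω i`,
`F i = p(1) / (1 - p(-1) u_{i,1} F_{i-1} - p(-2) u_{i,2} u_{i-1,3} F_{i-1} F_{i-2})` and `F i = 1`
for `i < 0`. For the walk this is optional stopping for the martingale given by the product of the
weights of the past jumps with `∏ F j` over the sites `j` still to be passed.

The formula for `T_n` holds path by path: a step `-1` or `-2` costs `2` or `3` units of time with
respect to a walk that only moves to the right, and these costs are counted by `(2, 1, 2)`, as every
jump by `-2` from `i` contributes to `U_{i, 2}` and to `U_{i - 1, 3}`.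
-/

namespace RWRE

/-! ### Functions of disjoint families of independent coordinates -/

section Independence

variable {ι : Type*} {X : ι → Type*} [∀ i, MeasurableSpace (X i)] {α β : Type*}
  [MeasurableSpace α] [MeasurableSpace β]

theorem measurable_iSup_comap_of_dependsOn [∀ i, Nonempty (X i)] {f : (∀ i, X i) → α} {s : Set ι}
    (hf : Measurable f) (hs : DependsOn f s) :
    Measurable[⨆ i ∈ s, MeasurableSpace.comap (Function.eval i) inferInstance] f := by
  classical
  let x₀ : ∀ i, X i := fun i => Classical.arbitrary (X i)
  have hfs : f = f ∘ fun x i => if i ∈ s then x i else x₀ i :=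
    funext fun x => hs fun i hi => (if_pos hi).symm
  rw [hfs]
  refine hf.comp (@measurable_pi_lambda _ _ _ (_) _ _ fun i => ?_)
  by_cases hi : i ∈ s
  · simp only [hi, if_true]
    exact Measurable.of_comap_le (le_iSup₂_of_le i hi le_rfl)
  · simp only [hi, if_false]
    exact measurable_const

theorem indepFun_infinitePi_of_dependsOn (μ : ∀ i, Measure (X i))
    [∀ i, IsProbabilityMeasure (μ i)] {f : (∀ i, X i) → α} {g : (∀ i, X i) → β} {s t : Set ι}
    (hf : Measurable f) (hg : Measurable g) (hs : DependsOn f s) (ht : DependsOn g t)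
    (hst : Disjoint s t) : IndepFun f g (Measure.infinitePi μ) := by
  have : ∀ i, Nonempty (X i) := fun i => nonempty_of_isProbabilityMeasure (μ i)
  have hcoord : iIndep (fun i => MeasurableSpace.comap (Function.eval i) inferInstance)
      (Measure.infinitePi μ) := (iIndepFun_infinitePi fun _ => measurable_id).iIndep
  rw [IndepFun_iff_Indep]
  exact indep_of_indep_of_le
    (indep_iSup_of_disjoint (fun i => (measurable_pi_apply i).comap_le) hcoord hst)
    (measurable_iSup_comap_of_dependsOn hf hs).comap_le
    (measurable_iSup_comap_of_dependsOn hg ht).comap_le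

end Independence

theorem measurePreserving_reindex_infinitePi {ι κ E : Type*} [MeasurableSpace E] (μ : Measure E)
    [IsProbabilityMeasure μ] {e : κ → ι} (he : e.Injective) :
    MeasurePreserving (fun x : ι → E => x ∘ e) (Measure.infinitePi fun _ => μ)
      (Measure.infinitePi fun _ => μ) :=
  ⟨by fun_prop, Measure.map_infinitePi_infinitePi_of_inj he⟩

theorem strong_law_ae_reindex {ι κ E : Type*} [MeasurableSpace E] (μ : Measure E)
    [IsProbabilityMeasure μ] {e : ℕ → κ → ι} (he : ∀ i, (e i).Injective) {s : Set κ}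
    (hs : Pairwise (Function.onFun Disjoint fun i => e i '' s)) {g : (κ → E) → ℝ}
    (hg : Measurable g) (hgs : DependsOn g s)
    (hint : Integrable g (Measure.infinitePi fun _ => μ)) :
    ∀ᵐ x ∂Measure.infinitePi (fun _ : ι => μ),
      Tendsto (fun n : ℕ => (∑ i ∈ Finset.range n, g (x ∘ e i)) / n) atTop
        (𝓝 (∫ y, g y ∂Measure.infinitePi fun _ => μ)) := by
  have hpres := fun i => measurePreserving_reindex_infinitePi μ (he i)
  have hdep : ∀ i, DependsOn (fun x : ι → E => g (x ∘ e i)) (e i '' s) := fun i x y h =>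
    hgs fun k hk => h (e i k) (Set.mem_image_of_mem _ hk)
  have hlim := strong_law_ae_real (μ := Measure.infinitePi fun _ : ι => μ)
    (fun i x => g (x ∘ e i)) ((hpres 0).integrable_comp_of_integrable hint)
    (fun i j hij => indepFun_infinitePi_of_dependsOn _ (hg.comp (hpres i).measurable)
      (hg.comp (hpres j).measurable) (hdep i) (hdep j) (hs hij))
    (fun i => IdentDistrib.comp (u := g)
      ⟨(hpres i).aemeasurable, (hpres 0).aemeasurable, (hpres i).map_eq.trans (hpres 0).map_eq.symm⟩
      hg)
  have hmean : ∫ x, g (x ∘ e 0) ∂Measure.infinitePi (fun _ : ι => μ)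
      = ∫ y, g y ∂Measure.infinitePi fun _ => μ := by
    rw [← (hpres 0).map_eq, integral_map (hpres 0).aemeasurable hg.aestronglyMeasurable]
  rwa [hmean] at hlim

/-! ### Exponential decay of ordered products -/

/-- The ordered product `A 0 * A 1 * ⋯ * A (n - 1)` in a noncommutative monoid. -/
def orderedProd {M : Type*} [Monoid M] (A : ℕ → M) (n : ℕ) : M :=
  ((List.range n).map A).prod

section OrderedProd

variable {M : Type*} [Monoid M]

@[simp] theorem orderedProd_zero (A : ℕ → M) : orderedProd A 0 = 1 := rfl

theorem orderedProd_succ (A : ℕ → M) (n : ℕ) :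
    orderedProd A (n + 1) = orderedProd A n * A n :=
  List.prod_range_succ A n

theorem orderedProd_succ' (A : ℕ → M) (n : ℕ) :
    orderedProd A (n + 1) = A 0 * orderedProd (fun k => A (k + 1)) n :=
  List.prod_range_succ' A n

theorem orderedProd_add (A : ℕ → M) (m n : ℕ) :
    orderedProd A (m + n) = orderedProd A m * orderedProd (fun k => A (m + k)) n := by
  induction n with
  | zero => simp
  | succ n ih => rw [← add_assoc, orderedProd_succ, ih, orderedProd_succ, mul_assoc]

theorem dependsOn_orderedProd (n : ℕ) : DependsOn (fun A : ℕ → M => orderedProd A n) (Set.Iio n) :=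
  fun _ _ h => congrArg List.prod (List.map_congr_left fun k hk => h k (List.mem_range.1 hk))

end OrderedProd

theorem summable_comp_div {f : ℕ → ℝ} (hf : Summable f) {N : ℕ} (hN : 0 < N) :
    Summable fun m => f (m / N) := by
  have : NeZero N := ⟨hN.ne'⟩
  refine (Nat.divModEquiv N).symm.summable_iff.1 ?_
  have hfst : Summable fun q : ℕ × Fin N => f q.1 * 1 :=
    summable_mul_of_summable_norm (g := fun _ : Fin N => (1 : ℝ)) hf.norm Summable.of_finite
  refine hfst.congr fun q => ?_
  have hq : (N * q.1 + q.2 : ℕ) / N = q.1 := by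
    rw [Nat.mul_add_div hN, Nat.div_eq_of_lt q.2.2, add_zero]
  simp [Nat.divModEquiv, mul_comm q.1, hq]

theorem summable_exp_of_tendsto_div {S : ℕ → ℝ} {γ : ℝ} (hγ : γ < 0)
    (hS : Tendsto (fun k : ℕ => S k / k) atTop (𝓝 γ)) : Summable fun k => Real.exp (S k) := by
  have hgeo : Summable fun k : ℕ => Real.exp (k * (γ / 2)) :=
    Real.summable_exp_nat_mul_iff.2 (by linarith)
  refine hgeo.of_norm_bounded_eventually_nat ?_
  filter_upwards [hS.eventually_lt_const (show γ < γ / 2 by linarith), eventually_gt_atTop 0]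
    with k hk hk0
  rw [Real.norm_of_nonneg (Real.exp_nonneg _), Real.exp_le_exp, mul_comm]
  exact ((div_lt_iff₀ (Nat.cast_pos.2 hk0)).1 hk).le

theorem tendsto_block_increment_div {c : ℕ → ℝ} {w : ℝ}
    (hc : Tendsto (fun n : ℕ => c n / n) atTop (𝓝 w)) {N : ℕ} (hN : 0 < N) :
    Tendsto (fun k : ℕ => (c (N * (k + 1)) - c (N * k)) / k) atTop (𝓝 0) := by
  have hN' : (N : ℝ) ≠ 0 := by positivity
  have hblock : Tendsto (fun k : ℕ => c (N * k) / k) atTop (𝓝 (w * N)) := by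
    refine ((hc.comp (tendsto_id.const_mul_atTop' hN)).mul_const (N : ℝ)).congr fun k => ?_
    simp only [Function.comp_apply, id, Nat.cast_mul]
    field_simp
  have hnext : Tendsto (fun k : ℕ => c (N * (k + 1)) / k) atTop (𝓝 (w * N)) := by
    have h := (hblock.comp (tendsto_add_atTop_nat 1)).mul
      ((tendsto_natCast_div_add_atTop (1 : ℝ)).inv₀ one_ne_zero)
    simp only [inv_div, inv_one, mul_one] at h
    refine h.congr fun k => ?_
    have : (k : ℝ) + 1 ≠ 0 := by positivity
    simp only [Function.comp_apply, Nat.cast_add, Nat.cast_one]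
    rw [div_mul_div_cancel₀ this]
  simpa only [sub_div, sub_self] using hnext.sub hblock

section NormedRing

variable {R : Type*} [NormedRing R] [NormOneClass R]

theorem norm_orderedProd_le_prod {A : ℕ → R} {B : ℕ → ℝ} (hAB : ∀ k, ‖A k‖ ≤ B k) (n : ℕ) :
    ‖orderedProd A n‖ ≤ ∏ k ∈ Finset.range n, B k := by
  induction n with
  | zero => simp
  | succ n ih =>
    rw [orderedProd_succ, Finset.prod_range_succ]
    exact norm_mul_le_of_le ih (hAB n)

theorem norm_orderedProd_mul_le_exp (A : ℕ → R) (N k : ℕ) :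
    ‖orderedProd A (N * k)‖
      ≤ Real.exp (∑ i ∈ Finset.range k, Real.log ‖orderedProd (fun r => A (N * i + r)) N‖) := by
  induction k with
  | zero => simp
  | succ k ih =>
    rw [Nat.mul_succ, orderedProd_add, Finset.sum_range_succ, Real.exp_add]
    exact norm_mul_le_of_le ih (Real.le_exp_log _)

theorem norm_orderedProd_mul_le_exp_blocks {A : ℕ → R} {B : ℕ → ℝ} (hAB : ∀ k, ‖A k‖ ≤ B k)
    (hB : ∀ k, 1 ≤ B k) {N : ℕ} (hN : 0 < N) (m : ℕ) :
    ‖orderedProd A m‖ * B m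
      ≤ Real.exp (∑ i ∈ Finset.range (m / N), Real.log ‖orderedProd (fun r => A (N * i + r)) N‖
        + (∑ i ∈ Finset.range (N * (m / N + 1)), Real.log (B i)
          - ∑ i ∈ Finset.range (N * (m / N)), Real.log (B i))) := by
  have hB0 : ∀ k, 0 < B k := fun k => zero_lt_one.trans_le (hB k)
  set k := m / N
  have hm : N * k + m % N = m := Nat.div_add_mod m N
  have hlast : ‖orderedProd (fun r => A (N * k + r)) (m % N)‖ * B m
      ≤ ∏ r ∈ Finset.range N, B (N * k + r) :=
    calc _ ≤ (∏ r ∈ Finset.range (m % N), B (N * k + r)) * B m := by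
          gcongr
          · exact (hB0 m).le
          · exact norm_orderedProd_le_prod (fun r => hAB _) _
      _ = ∏ r ∈ Finset.range (m % N + 1), B (N * k + r) := by rw [Finset.prod_range_succ, hm]
      _ ≤ _ := Finset.prod_le_prod_of_subset_of_one_le
          (Finset.range_subset_range.2 (Nat.mod_lt m hN)) (fun r _ => (hB0 _).le) fun r _ _ => hB _
  have hexp : ∏ r ∈ Finset.range N, B (N * k + r)
      = Real.exp (∑ i ∈ Finset.range (N * (k + 1)), Real.log (B i)
        - ∑ i ∈ Finset.range (N * k), Real.log (B i)) := by
    rw [Nat.mul_succ, Finset.sum_range_add, add_sub_cancel_left, Real.exp_sum]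
    exact Finset.prod_congr rfl fun r _ => (Real.exp_log (hB0 _)).symm
  calc ‖orderedProd A m‖ * B m
      ≤ ‖orderedProd A (N * k)‖ * (‖orderedProd (fun r => A (N * k + r)) (m % N)‖ * B m) := by
        rw [← mul_assoc]
        conv_lhs => rw [← hm, orderedProd_add, hm]
        exact mul_le_mul_of_nonneg_right (norm_mul_le _ _) (hB0 m).le
    _ ≤ _ := by
        rw [Real.exp_add, ← hexp]
        exact mul_le_mul (norm_orderedProd_mul_le_exp A N k) hlast
          (mul_nonneg (norm_nonneg _) (hB0 m).le) (Real.exp_nonneg _)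

theorem summable_norm_orderedProd_mul {A : ℕ → R} {B : ℕ → ℝ} (hAB : ∀ k, ‖A k‖ ≤ B k)
    (hB : ∀ k, 1 ≤ B k) {N : ℕ} (hN : 0 < N) {γ w : ℝ} (hγ : γ < 0)
    (hblock : Tendsto (fun k : ℕ => (∑ i ∈ Finset.range k,
      Real.log ‖orderedProd (fun r => A (N * i + r)) N‖) / k) atTop (𝓝 γ))
    (hlog : Tendsto (fun n : ℕ => (∑ i ∈ Finset.range n, Real.log (B i)) / n) atTop (𝓝 w)) :
    Summable fun m => ‖orderedProd A m‖ * B m := by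
  have hexponent := hblock.add (tendsto_block_increment_div hlog hN)
  simp only [← add_div, add_zero] at hexponent
  exact (summable_comp_div (summable_exp_of_tendsto_div hγ hexponent) hN).of_nonneg_of_le
    (fun m => mul_nonneg (norm_nonneg _) (zero_le_one.trans (hB m)))
    (norm_orderedProd_mul_le_exp_blocks hAB hB hN)

end NormedRing

theorem ae_summable_norm_orderedProd_mul {ι E R : Type*} [MeasurableSpace E] (μ : Measure E)
    [IsProbabilityMeasure μ] [NormedRing R] [NormOneClass R] {A : E → R} {B : E → ℝ}
    (hAB : ∀ᵐ p ∂μ, ‖A p‖ ≤ B p ∧ 1 ≤ B p) {N : ℕ} (hN : 0 < N)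
    (hA : Measurable fun σ : ℕ → E => ‖orderedProd (fun k => A (σ k)) N‖)
    (hB : Measurable B) (hint : Integrable (fun p => Real.log (B p)) μ)
    (hneg : ∫ σ : ℕ → E, Real.log ‖orderedProd (fun k => A (σ k)) N‖
      ∂Measure.infinitePi (fun _ => μ) < 0) {e : ℕ → ι} (he : e.Injective) :
    ∀ᵐ x ∂Measure.infinitePi (fun _ : ι => μ),
      Summable fun m => ‖orderedProd (fun k => A (x (e k))) m‖ * B (x (e m)) := by
  have hdep : DependsOn (fun σ : ℕ → E => Real.log ‖orderedProd (fun k => A (σ k)) N‖)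
      (Set.Iio N) := fun σ τ h =>
    congrArg (fun M => Real.log ‖M‖) (dependsOn_orderedProd N fun k hk => congrArg A (h k hk))
  have hinj : ∀ i, Function.Injective fun r => e (N * i + r) := fun i =>
    he.comp (add_right_injective _)
  have hdisj : Pairwise
      (Function.onFun Disjoint fun i => (fun r => e (N * i + r)) '' Set.Iio N) := by
    intro i j hij
    rw [Function.onFun, Set.disjoint_left]
    rintro _ ⟨r, hr, rfl⟩ ⟨s, hs, hrs⟩
    have hdiv := congrArg (· / N) (he hrs)
    simp only [Nat.mul_add_div hN, Nat.div_eq_of_lt hr, Nat.div_eq_of_lt hs, add_zero] at hdiv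
    exact hij hdiv.symm
  have hblocks := strong_law_ae_reindex μ hinj hdisj hA.log hdep
    (not_imp_comm.1 integral_undef hneg.ne)
  have hsites := strong_law_ae_reindex μ (e := fun i (_ : Unit) => e i) (s := Set.univ)
    (fun i => Function.injective_of_subsingleton _) (by
      intro i j hij
      simpa [Function.onFun] using fun h => hij (he h))
    (hB.comp (measurable_pi_apply ())).log (dependsOn_univ _)
    ((measurePreserving_eval_infinitePi (fun _ : Unit => μ) ()).integrable_comp_of_integrable hint)
  have hbound : ∀ᵐ x ∂Measure.infinitePi (fun _ : ι => μ), ∀ k,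
      ‖A (x (e k))‖ ≤ B (x (e k)) ∧ 1 ≤ B (x (e k)) := ae_all_iff.2 fun k =>
    (measurePreserving_eval_infinitePi (fun _ : ι => μ) (e k)).quasiMeasurePreserving.ae hAB
  filter_upwards [hblocks, hsites, hbound] with x hx hx' hxB
  exact summable_norm_orderedProd_mul (fun k => (hxB k).1) (fun k => (hxB k).2) hN hneg hx hx'

/-! ### Mean passage times -/

section Matrix

variable {n : Type*} [Fintype n] [DecidableEq n]

theorem orderedProd_nonneg {A : ℕ → Matrix n n ℝ} (hA : ∀ k i j, 0 ≤ A k i j) (m : ℕ) (i j : n) :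
    0 ≤ orderedProd A m i j := by
  induction m generalizing i j with
  | zero => rw [orderedProd_zero, Matrix.one_apply]; split_ifs <;> norm_num
  | succ m ih =>
    rw [orderedProd_succ, Matrix.mul_apply]
    exact Finset.sum_nonneg fun k _ => mul_nonneg (ih i k) (hA m k j)

theorem measurable_orderedProd_apply {α : Type*} [MeasurableSpace α] {A : ℕ → α → Matrix n n ℝ}
    (hA : ∀ k i j, Measurable fun x => A k x i j) (m : ℕ) (i j : n) :
    Measurable fun x => orderedProd (fun k => A k x) m i j := by
  induction m generalizing i j with
  | zero => exact measurable_const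
  | succ m ih =>
    simp only [orderedProd_succ, Matrix.mul_apply]
    exact Finset.measurable_sum _ fun k _ => (ih i k).mul (hA m k j)

theorem exists_nonneg_affine_recursion {A : ℤ → Matrix n n ℝ} {b : ℤ → n → ℝ}
    (hA : ∀ j i l, 0 ≤ A j i l) (hb : ∀ j, 0 ≤ b j)
    (hsum : ∀ j : ℤ, Summable fun m : ℕ =>
      (orderedProd (fun k => A (j - k)) m).mulVec (b (j - m))) :
    ∃ S : ℤ → n → ℝ, (∀ j, 0 ≤ S j) ∧ ∀ j, S j = b j + (A j).mulVec (S (j - 1)) := by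
  have hsucc : ∀ (j : ℤ) (m : ℕ),
      (orderedProd (fun k => A (j - k)) (m + 1)).mulVec (b (j - (m + 1 : ℕ)))
        = (A j).mulVec ((orderedProd (fun k => A (j - 1 - k)) m).mulVec (b (j - 1 - m))) := by
    intro j m
    simp only [orderedProd_succ', Matrix.mulVec_mulVec, Nat.cast_add, Nat.cast_one, Nat.cast_zero,
      sub_zero, sub_add_eq_sub_sub, sub_right_comm j _ (1 : ℤ)]
  refine ⟨fun j => ∑' m : ℕ, (orderedProd (fun k => A (j - k)) m).mulVec (b (j - m)), fun j => ?_,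
    fun j => ?_⟩
  · exact tsum_nonneg fun m i =>
      Finset.sum_nonneg fun l _ => mul_nonneg (orderedProd_nonneg (fun _ => hA _) m i l) (hb _ l)
  · have htail := ((hsum (j - 1)).hasSum.map (A j).mulVecLin
      (LinearMap.continuous_of_finiteDimensional _)).tsum_eq
    simp only [Function.comp_def, Matrix.mulVecLin_apply, ← hsucc] at htail
    simp only [(hsum j).tsum_eq_zero_add, htail, orderedProd_zero, Matrix.one_mulVec, Nat.cast_zero,
      sub_zero]

end Matrix

/-- `h j` satisfies the equations of the mean time a walk in the environment `ω` needs to pass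
from `j` to `j + 1`, obtained by conditioning on the first step.  Only the equations are needed, so
no probabilistic interpretation is built in. -/
structure IsMeanPassageTime (ω : Env) (h : ℤ → ℝ) : Prop where
  nonneg : ∀ j, 0 ≤ h j
  eq : ∀ j, prob (ω j) 1 * h j
    = 1 + (prob (ω j) (-1) + prob (ω j) (-2)) * h (j - 1) + prob (ω j) (-2) * h (j - 2)

theorem meanMatrix_nonneg (p : StepLaw) (i j : Fin 3) : 0 ≤ meanMatrix p i j := by
  have h0 := div_nonneg (prob_nonneg p (-1)) (prob_nonneg p 1)
  have h1 := div_nonneg (prob_nonneg p (-2)) (prob_nonneg p 1)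
  fin_cases i <;> fin_cases j <;> simp [meanMatrix, h0, h1]

/-- The solution of the affine recursion driven by `meanMatrix` lists the mean passage times as
`(h j, h j + h (j - 1), h j)`. -/
theorem exists_isMeanPassageTime {ω : Env} (hω : ∀ j, 0 < prob (ω j) 1)
    (hsum : ∀ j : ℤ, Summable fun m : ℕ =>
      (orderedProd (fun k => meanMatrix (ω (j - k))) m).mulVec fun _ => (prob (ω (j - m)) 1)⁻¹) :
    ∃ h, IsMeanPassageTime ω h := by
  obtain ⟨S, hS0, hS⟩ := exists_nonneg_affine_recursion (A := fun j => meanMatrix (ω j))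
    (b := fun j _ => (prob (ω j) 1)⁻¹) (fun j => meanMatrix_nonneg (ω j))
    (fun j _ => inv_nonneg.2 (hω j).le) hsum
  have h0 : ∀ j, S j 0 = (prob (ω j) 1)⁻¹ + (prob (ω j) (-1) / prob (ω j) 1 * S (j - 1) 0
      + prob (ω j) (-2) / prob (ω j) 1 * S (j - 1) 1) := fun j => by
    conv_lhs => rw [hS j]
    simp [dotProduct, Fin.sum_univ_three, meanMatrix]
  have h2 : ∀ j, S j 2 = S j 0 := fun j => by
    rw [hS j]
    simp [dotProduct, Fin.sum_univ_three, meanMatrix]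
  have h1 : ∀ j, S j 1 = S j 0 + S (j - 1) 0 := fun j => by
    conv_lhs => rw [hS j]
    rw [h0 j]
    simp [dotProduct, Fin.sum_univ_three, meanMatrix, h2, add_assoc]
  refine ⟨fun j => S j 0, fun j => hS0 j 0, fun j => ?_⟩
  have := (hω j).ne'
  rw [h0 j, h1 (j - 1), show j - 1 - 1 = j - 2 by ring]
  field_simp
  ring

theorem measurable_prob (l : ℤ) : Measurable fun p : StepLaw => prob p l := by
  have h : ∀ i : Fin 3, Measurable fun p : StepLaw => p i := fun i =>
    (measurable_pi_apply i).comp measurable_subtype_coe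
  unfold prob
  split_ifs
  exacts [h 0, h 1, h 2, measurable_const]

theorem measurable_meanMatrix_apply (i j : Fin 3) :
    Measurable fun p : StepLaw => meanMatrix p i j := by
  have h0 := (measurable_prob (-1)).div (measurable_prob 1)
  have h1 := (measurable_prob (-2)).div (measurable_prob 1)
  fin_cases i <;> fin_cases j <;>
    first
    | exact h0
    | exact h1
    | exact measurable_const

theorem prob_one_le_one (p : StepLaw) : prob p 1 ≤ 1 := by
  linarith [prob_sum p, prob_nonneg p (-1), prob_nonneg p (-2)]

section MatrixNorm

attribute [local instance] Matrix.linftyOpNormedAddCommGroup Matrix.linftyOpNormedRing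
  Matrix.linfty_opNormOneClass

theorem measurable_linftyOpNorm {α m n : Type*} [MeasurableSpace α] [Fintype m] [Fintype n]
    {A : α → Matrix m n ℝ} (hA : ∀ i j, Measurable fun x => A x i j) :
    Measurable fun x => ‖A x‖ := by
  have hsup : Measurable (Finset.univ.sup fun (i : m) (x : α) => ∑ j, ‖A x i j‖₊) :=
    Finset.sup_induction measurable_const (fun _ h _ h' => h.sup h') fun i _ =>
      Finset.measurable_sum _ fun j _ => (hA i j).nnnorm
  simpa only [Matrix.linfty_opNorm_def, Finset.sup_apply] using hsup.coe_nnreal_real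

theorem norm_meanMatrix_le {p : StepLaw} (hp : 0 < prob p 1) : ‖meanMatrix p‖ ≤ (prob p 1)⁻¹ := by
  have hrow : prob p (-1) / prob p 1 + prob p (-2) / prob p 1 + 1 = (prob p 1)⁻¹ := by
    field_simp
    linarith [prob_sum p]
  rw [Matrix.linfty_opNorm_def, ← Real.coe_toNNReal _ (inv_nonneg.2 hp.le), NNReal.coe_le_coe]
  refine Finset.sup_le fun i _ => ?_
  rw [← NNReal.coe_le_coe, Real.coe_toNNReal _ (inv_nonneg.2 hp.le), ← hrow]
  push_cast
  simp only [Fin.sum_univ_three, Real.norm_of_nonneg (meanMatrix_nonneg p i _)]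
  fin_cases i <;> simp [meanMatrix]

theorem measurable_norm_orderedProd_meanMatrix (N : ℕ) :
    Measurable fun σ : ℕ → StepLaw => ‖orderedProd (fun k => meanMatrix (σ k)) N‖ :=
  measurable_linftyOpNorm (measurable_orderedProd_apply (fun k i j =>
    (measurable_meanMatrix_apply i j).comp (measurable_pi_apply k)) N)

theorem exists_integral_log_norm_orderedProd_neg {ν : Measure StepLaw} [IsProbabilityMeasure ν]
    (hγ : topLyapunov ν < 0) :
    ∃ N > 0, ∫ σ : ℕ → StepLaw, Real.log ‖orderedProd (fun k => meanMatrix (σ k)) N‖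
      ∂Measure.infinitePi (fun _ => ν) < 0 := by
  obtain ⟨N, hlt, hN⟩ := ((eventually_lt_of_limsup_lt hγ).and (eventually_gt_atTop 0)).exists
  refine ⟨N, hN, ?_⟩
  have hmean : (∫ ω : Env, Real.log ‖orderedProd (fun k => meanMatrix (ω (k : ℤ))) N‖ ∂envLaw ν) / N
      < 0 := by
    have h := EReal.coe_lt_coe_iff.1 (hlt.trans_eq EReal.coe_zero.symm)
    simp only [List.bind_eq_flatMap, List.pure_def, ← List.map_eq_flatMap, List.map_map] at h
    exact h
  have hpres := measurePreserving_reindex_infinitePi ν (Nat.cast_injective (R := ℤ))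
  rw [← hpres.map_eq, integral_map hpres.aemeasurable
    (measurable_norm_orderedProd_meanMatrix N).log.aestronglyMeasurable]
  exact ((div_neg_iff.1 hmean).resolve_left fun h => h.2.not_ge N.cast_nonneg).1

theorem ae_prob_pos (ν : Measure StepLaw) [IsProbabilityMeasure ν] {l : ℤ}
    (h : ∀ᵐ p ∂ν, 0 < prob p l) : ∀ᵐ ω ∂envLaw ν, ∀ x : ℤ, 0 < prob (ω x) l :=
  ae_all_iff.2 fun x =>
    (measurePreserving_eval_infinitePi (fun _ : ℤ => ν) x).quasiMeasurePreserving.ae h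

theorem ae_exists_isMeanPassageTime (ν : Measure StepLaw) [IsProbabilityMeasure ν]
    (hpos : ∀ᵐ p ∂ν, 0 < prob p 1) (hint : Integrable (fun p => Real.log (prob p 1)) ν)
    (hγ : topLyapunov ν < 0) : ∀ᵐ ω ∂envLaw ν, ∃ h, IsMeanPassageTime ω h := by
  obtain ⟨N, hN, hneg⟩ := exists_integral_log_norm_orderedProd_neg hγ
  have hsum : ∀ᵐ ω ∂envLaw ν, ∀ j : ℤ, Summable fun m : ℕ =>
      ‖orderedProd (fun k => meanMatrix (ω (j - k))) m‖ * (prob (ω (j - m)) 1)⁻¹ := by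
    refine ae_all_iff.2 fun j => ae_summable_norm_orderedProd_mul (R := Matrix (Fin 3) (Fin 3) ℝ)
      (B := fun p => (prob p 1)⁻¹) ν ?_ hN (measurable_norm_orderedProd_meanMatrix N)
      (measurable_prob 1).inv ?_ hneg (e := fun k : ℕ => j - k) fun k l h => by simpa using h
    · filter_upwards [hpos] with p hp
      exact ⟨norm_meanMatrix_le hp, (one_le_inv₀ hp).2 (prob_one_le_one p)⟩
    · simp only [Real.log_inv]
      exact hint.neg
  filter_upwards [hsum, ae_prob_pos ν hpos] with ω hω hωpos
  refine exists_isMeanPassageTime hωpos fun j => .of_norm_bounded (hω j) fun m => ?_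
  refine (Matrix.linfty_opNorm_mulVec _ _).trans_eq ?_
  rw [pi_norm_const, Real.norm_of_nonneg (inv_nonneg.2 (hωpos _).le)]

end MatrixNorm

/-! ### One step of the walk -/

theorem exists_comp_frestrictLe_of_dependsOn {X : ℕ → Type*} {t : ℕ} {α : Type*} [Nonempty α]
    {f : (∀ n, X n) → α} (hf : DependsOn f (Set.Iic t)) :
    ∃ g, f = g ∘ Preorder.frestrictLe (π := X) t :=
  (Function.factorsThrough_iff f).1 fun _ _ h =>
    hf fun i hi => congrFun h ⟨i, Finset.mem_Iic.2 hi⟩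

section Trajectory

variable {X : ℕ → Type*} [∀ n, MeasurableSpace (X n)]
  {κ : ∀ n, Kernel (∀ i : Finset.Iic n, X i) (X (n + 1))} [∀ n, IsMarkovKernel (κ n)]
  {a t : ℕ} (x₀ : ∀ i : Finset.Iic a, X i)

theorem traj_map_frestrictLe_prod (hat : a ≤ t) :
    (Kernel.traj κ a x₀).map (fun x => (Preorder.frestrictLe (π := X) t x, x (t + 1)))
      = (Kernel.traj κ a x₀).map (Preorder.frestrictLe (π := X) t) ⊗ₘ κ t := by
  rw [Kernel.traj_map_frestrictLe_apply, Kernel.partialTraj_compProd_eq_map_traj hat]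

theorem lintegral_traj_succ (hat : a ≤ t) {F : (∀ i : Finset.Iic t, X i) × X (t + 1) → ENNReal}
    (hF : Measurable F) :
    ∫⁻ x, F (Preorder.frestrictLe t x, x (t + 1)) ∂Kernel.traj κ a x₀
      = ∫⁻ x, ∫⁻ z, F (Preorder.frestrictLe t x, z) ∂κ t (Preorder.frestrictLe t x)
          ∂Kernel.traj κ a x₀ := by
  rw [← lintegral_map hF (by fun_prop), traj_map_frestrictLe_prod x₀ hat,
    Measure.lintegral_compProd hF,
    lintegral_map hF.lintegral_kernel_prod_right' (Preorder.measurable_frestrictLe t)]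

theorem integral_traj_succ {E : Type*} [NormedAddCommGroup E] [NormedSpace ℝ E] (hat : a ≤ t)
    {F : (∀ i : Finset.Iic t, X i) × X (t + 1) → E} (hF : StronglyMeasurable F)
    (hint : Integrable (fun x => F (Preorder.frestrictLe t x, x (t + 1))) (Kernel.traj κ a x₀)) :
    ∫ x, F (Preorder.frestrictLe t x, x (t + 1)) ∂Kernel.traj κ a x₀
      = ∫ x, ∫ z, F (Preorder.frestrictLe t x, z) ∂κ t (Preorder.frestrictLe t x)
          ∂Kernel.traj κ a x₀ := by
  have hpair : Measurable fun x => (Preorder.frestrictLe (π := X) t x, x (t + 1)) := by fun_prop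
  have : SFinite ((Kernel.traj κ a x₀).map (Preorder.frestrictLe (π := X) t)) := inferInstance
  rw [← integral_map hpair.aemeasurable hF.aestronglyMeasurable, traj_map_frestrictLe_prod x₀ hat,
    Measure.integral_compProd, integral_map (Preorder.measurable_frestrictLe t).aemeasurable
      (StronglyMeasurable.integral_kernel_prod_right' hF).aestronglyMeasurable]
  rw [← traj_map_frestrictLe_prod x₀ hat]
  exact (integrable_map_measure hF.aestronglyMeasurable hpair.aemeasurable).2 hint

theorem measurable_of_dependsOn_Iic [∀ n, Countable (X n)] [∀ n, MeasurableSingletonClass (X n)]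
    {α : Type*} [MeasurableSpace α] [Nonempty α] {f : (∀ n, X n) → α}
    (hf : DependsOn f (Set.Iic t)) : Measurable f := by
  obtain ⟨g, rfl⟩ := exists_comp_frestrictLe_of_dependsOn hf
  exact (measurable_of_countable g).comp (Preorder.measurable_frestrictLe t)

end Trajectory

instance isProbabilityMeasure_quenchedLaw (ω : Env) : IsProbabilityMeasure (quenchedLaw ω) := by
  unfold quenchedLaw
  infer_instance

section Step

variable (ω : Env)

theorem integrable_stepMeasure {E : Type*} [NormedAddCommGroup E] (x : ℤ) (g : ℤ → E) :
    Integrable g (stepMeasure ω x) := by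
  have hdirac : ∀ (c : ℝ) (y : ℤ), Integrable g (ENNReal.ofReal c • Measure.dirac y) := fun c y =>
    (integrable_dirac (by simp)).smul_measure ENNReal.ofReal_ne_top
  exact ((hdirac _ _).add_measure (hdirac _ _)).add_measure (hdirac _ _)

theorem integral_stepMeasure {E : Type*} [NormedAddCommGroup E] [NormedSpace ℝ E]
    [CompleteSpace E] (x : ℤ) (g : ℤ → E) :
    ∫ z, g z ∂stepMeasure ω x = prob (ω x) (-2) • g (x - 2)
      + prob (ω x) (-1) • g (x - 1) + prob (ω x) 1 • g (x + 1) := by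
  have hg := integrable_stepMeasure ω x g
  rw [stepMeasure, integrable_add_measure, integrable_add_measure] at hg
  rw [stepMeasure, integral_add_measure (hg.1.1.add_measure hg.1.2) hg.2,
    integral_add_measure hg.1.1 hg.1.2]
  simp only [integral_smul_measure, integral_dirac, ENNReal.toReal_ofReal (prob_nonneg _ _)]

theorem lintegral_quenchedLaw_succ {t : ℕ} {F : (ℕ → ℤ) → ℤ → ENNReal}
    (hF : DependsOn F (Set.Iic t)) :
    ∫⁻ X, F X (X (t + 1)) ∂quenchedLaw ω
      = ∫⁻ X, ∫⁻ z, F X z ∂stepMeasure ω (X t) ∂quenchedLaw ω := by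
  obtain ⟨K, rfl⟩ := exists_comp_frestrictLe_of_dependsOn (X := fun _ => ℤ) hF
  exact lintegral_traj_succ (X := fun _ => ℤ) (κ := stepKernel ω) _ t.zero_le
    (measurable_of_countable fun q => K q.1 q.2)

theorem integral_quenchedLaw_succ {E : Type*} [NormedAddCommGroup E] [NormedSpace ℝ E] {t : ℕ}
    {F : (ℕ → ℤ) → ℤ → E} (hF : DependsOn F (Set.Iic t)) {C : ℝ} (hC : ∀ X z, ‖F X z‖ ≤ C) :
    ∫ X, F X (X (t + 1)) ∂quenchedLaw ω
      = ∫ X, ∫ z, F X z ∂stepMeasure ω (X t) ∂quenchedLaw ω := by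
  obtain ⟨K, rfl⟩ := exists_comp_frestrictLe_of_dependsOn (X := fun _ => ℤ) hF
  have hK : StronglyMeasurable fun q : (∀ i : Finset.Iic t, (fun _ => ℤ) i) × ℤ => K q.1 q.2 :=
    .of_discrete
  exact integral_traj_succ (X := fun _ => ℤ) (κ := stepKernel ω) _ t.zero_le hK
    (.of_bound (hK.comp_measurable (by fun_prop)).aestronglyMeasurable C
      (ae_of_all _ fun X => hC X _))

/-- The paths that the walk can follow. -/
def IsWalk (X : ℕ → ℤ) : Prop :=
  X 0 = 0 ∧ ∀ t, X (t + 1) = X t - 2 ∨ X (t + 1) = X t - 1 ∨ X (t + 1) = X t + 1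

theorem ae_stepMeasure (x : ℤ) :
    ∀ᵐ z ∂stepMeasure ω x, z = x - 2 ∨ z = x - 1 ∨ z = x + 1 := by
  simp only [stepMeasure, ae_add_measure_iff]
  exact ⟨⟨Measure.ae_smul_measure (by simp [ae_dirac_eq]) _,
    Measure.ae_smul_measure (by simp [ae_dirac_eq]) _⟩,
    Measure.ae_smul_measure (by simp [ae_dirac_eq]) _⟩

theorem ae_quenchedLaw_zero : ∀ᵐ X ∂quenchedLaw ω, X 0 = 0 := by
  have hstart : (quenchedLaw ω).map (Preorder.frestrictLe (π := fun _ : ℕ => ℤ) 0)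
      = Measure.dirac fun _ => 0 := by
    rw [quenchedLaw, Kernel.traj_map_frestrictLe_apply, Kernel.partialTraj_self, Kernel.id_apply]
  have hzero : ∀ᵐ y ∂(quenchedLaw ω).map (Preorder.frestrictLe (π := fun _ : ℕ => ℤ) 0),
      y ⟨0, Finset.mem_Iic.2 le_rfl⟩ = 0 := by
    rw [hstart, ae_dirac_eq]
    rfl
  exact ae_of_ae_map (by fun_prop) hzero

theorem ae_quenchedLaw_succ {P : ℤ → ℤ → Prop} (hP : ∀ x, ∀ᵐ z ∂stepMeasure ω x, P x z) (t : ℕ) :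
    ∀ᵐ X ∂quenchedLaw ω, P (X t) (X (t + 1)) := by
  classical
  have hstep := lintegral_quenchedLaw_succ ω (t := t)
    (F := fun X => {z | ¬ P (X t) z}.indicator 1) fun X Y h => by simp only [h t Set.self_mem_Iic]
  simp only [lintegral_indicator_one (Set.to_countable _).measurableSet, ae_iff.1 (hP _),
    lintegral_zero] at hstep
  have hmeas : Measurable fun X : ℕ → ℤ =>
      {z | ¬ P (X t) z}.indicator (1 : ℤ → ENNReal) (X (t + 1)) :=
    measurable_of_dependsOn_Iic (t := t + 1) fun X Y h => by
      rw [h t (Set.mem_Iic.2 t.le_succ), h (t + 1) Set.self_mem_Iic]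
  filter_upwards [(lintegral_eq_zero_iff hmeas).1 hstep] with X hX
  by_contra hc
  simp [hc] at hX

theorem ae_isWalk : ∀ᵐ X ∂quenchedLaw ω, IsWalk X :=
  (ae_quenchedLaw_zero ω).and (ae_all_iff.2 (ae_quenchedLaw_succ ω (ae_stepMeasure ω)))

end Step

/-! ### Hitting a level -/

/-- The path visits `n` at some time up to `t`. -/
def HitBy (n : ℤ) (t : ℕ) (X : ℕ → ℤ) : Prop := ∃ s ≤ t, X s = n

instance (n : ℤ) (t : ℕ) (X : ℕ → ℤ) : Decidable (HitBy n t X) :=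
  inferInstanceAs (Decidable (∃ s ≤ t, X s = n))

/-- `T` is the first time at which the path is at `n`. -/
def FirstHit (n : ℤ) (T : ℕ) (X : ℕ → ℤ) : Prop := X T = n ∧ ∀ s < T, X s ≠ n

section Hitting

variable {n : ℤ} {t T : ℕ} {X : ℕ → ℤ}

theorem hitBy_succ : HitBy n (t + 1) X ↔ HitBy n t X ∨ X (t + 1) = n := by
  simp [HitBy, Nat.le_succ_iff, or_and_right, exists_or]

theorem dependsOn_hitBy (n : ℤ) {s t : ℕ} (hst : s ≤ t) : DependsOn (HitBy n s) (Set.Iic t) :=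
  fun _ _ h => propext <| exists_congr fun r => and_congr_right fun hr => by
    rw [h r (Set.mem_Iic.2 (hr.trans hst))]

theorem exists_firstHit (h : ∃ t, HitBy n t X) : ∃ T, FirstHit n T X := by
  classical
  have hvisit : ∃ T, X T = n := h.elim fun _ ⟨s, _, hs⟩ => ⟨s, hs⟩
  exact ⟨Nat.find hvisit, Nat.find_spec hvisit, fun s hs => Nat.find_min hvisit hs⟩

theorem FirstHit.hitBy_iff (h : FirstHit n T X) : HitBy n t X ↔ T ≤ t :=
  ⟨fun ⟨s, hst, hs⟩ => (not_lt.1 fun hsT => h.2 s hsT hs).trans hst, fun hTt => ⟨T, hTt, h.1⟩⟩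

theorem IsWalk.lt_of_not_hitBy (hX : IsWalk X) (hn : 0 < n) (h : ¬ HitBy n t X) : X t < n := by
  induction t with
  | zero => rwa [hX.1]
  | succ t ih =>
    rw [hitBy_succ, not_or] at h
    have hlt := ih h.1
    rcases hX.2 t with hstep | hstep | hstep <;> omega

theorem FirstHit.lt (h : FirstHit n T X) (hX : IsWalk X) (hn : 0 < n) (htT : t < T) : X t < n :=
  hX.lt_of_not_hitBy hn (by rwa [h.hitBy_iff, not_le])

theorem FirstHit.pos (h : FirstHit n T X) (hX : IsWalk X) (hn : 0 < n) : 0 < T := by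
  rcases T.eq_zero_or_pos with rfl | hT
  · exact absurd (hX.1.symm.trans h.1) hn.ne
  · exact hT

theorem FirstHit.hittingTime_eq (h : FirstHit n T X) (hT : 0 < T) : hittingTime n X = T :=
  le_antisymm (iInf₂_le T ⟨hT, h.1⟩) (le_iInf₂ fun _ hs =>
    Nat.cast_le.2 (not_lt.1 fun hlt => h.2 _ hlt hs.2))

end Hitting

section FosterLyapunov

variable {ω : Env} {n : ℤ} {f : ℤ → ENNReal}

theorem measurableSet_not_hitBy (n : ℤ) (t : ℕ) : MeasurableSet {X : ℕ → ℤ | ¬ HitBy n t X} :=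
  measurableSet_setOfPred.2
    (measurable_of_dependsOn_Iic (t := t) fun _ _ h => congrArg Not (dependsOn_hitBy n le_rfl h))

theorem lintegral_survival_succ_le (hn : 0 < n)
    (hf : ∀ x < n, 1 + ∫⁻ z, f z ∂stepMeasure ω x ≤ f x) (t : ℕ) :
    (∫⁻ X, if HitBy n (t + 1) X then 0 else f (X (t + 1)) ∂quenchedLaw ω)
        + quenchedLaw ω {X | ¬ HitBy n t X}
      ≤ ∫⁻ X, if HitBy n t X then 0 else f (X t) ∂quenchedLaw ω := by
  rw [← lintegral_indicator_one (measurableSet_not_hitBy n t),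
    ← lintegral_add_right _ (measurable_one.indicator (measurableSet_not_hitBy n t))]
  calc _ ≤ ∫⁻ X, if HitBy n t X then 0 else 1 + f (X (t + 1)) ∂quenchedLaw ω := by
        refine lintegral_mono fun X => ?_
        by_cases hhit : HitBy n t X
        · simp [hhit, hitBy_succ]
        · by_cases hnext : X (t + 1) = n <;> simp [hhit, hnext, hitBy_succ, add_comm]
    _ = ∫⁻ X, ∫⁻ z, (if HitBy n t X then 0 else 1 + f z) ∂stepMeasure ω (X t) ∂quenchedLaw ω :=
        lintegral_quenchedLaw_succ ω (F := fun X z => if HitBy n t X then 0 else 1 + f z)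
          fun X Y h => by simp only [dependsOn_hitBy n le_rfl h]
    _ ≤ _ := by
        refine lintegral_mono_ae ?_
        filter_upwards [ae_isWalk ω] with X hX
        by_cases hhit : HitBy n t X
        · simp [hhit]
        · simpa [hhit, lintegral_add_left measurable_const] using
            hf _ (hX.lt_of_not_hitBy hn hhit)

theorem ae_exists_hitBy_of_drift (hn : 0 < n) (hf0 : f 0 ≠ ⊤)
    (hf : ∀ x < n, 1 + ∫⁻ z, f z ∂stepMeasure ω x ≤ f x) :
    ∀ᵐ X ∂quenchedLaw ω, ∃ t, HitBy n t X := by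
  set D : ℕ → ENNReal := fun t => ∫⁻ X, if HitBy n t X then 0 else f (X t) ∂quenchedLaw ω
  have hpartial : ∀ t, D t + ∑ s ∈ Finset.range t, quenchedLaw ω {X | ¬ HitBy n s X} ≤ D 0 := by
    intro t
    induction t with
    | zero => simp
    | succ t ih =>
      rw [Finset.sum_range_succ, add_comm (∑ _ ∈ _, _), ← add_assoc]
      exact (add_le_add_left (lintegral_survival_succ_le hn hf t) _).trans ih
  have hD0 : D 0 ≤ f 0 :=
    calc D 0 ≤ ∫⁻ _, f 0 ∂quenchedLaw ω := by
          refine lintegral_mono_ae ?_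
          filter_upwards [ae_quenchedLaw_zero ω] with X hX
          rw [hX]
          split_ifs <;> simp
      _ = f 0 := by simp
  have hsum : ∑' t, quenchedLaw ω {X | ¬ HitBy n t X} ≤ f 0 :=
    ENNReal.tsum_le_of_sum_range_le fun t => (le_add_self.trans (hpartial t)).trans hD0
  filter_upwards [ae_eventually_notMem (ne_top_of_le_ne_top hf0 hsum)] with X hX
  exact hX.exists.imp fun t ht => not_not.1 ht

end FosterLyapunov

theorem IsMeanPassageTime.one_add_integral {ω : Env} {h : ℤ → ℝ} (hh : IsMeanPassageTime ω h)
    {x n : ℤ} (hx : x < n) :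
    1 + ∫ z, ∑ j ∈ Finset.Ico z n, h j ∂stepMeasure ω x = ∑ j ∈ Finset.Ico x n, h j := by
  have hsplit : ∀ y < n, ∑ j ∈ Finset.Ico y n, h j = h y + ∑ j ∈ Finset.Ico (y + 1) n, h j :=
    fun y hy => by rw [← Finset.insert_Ico_add_one_left_eq_Ico hy, Finset.sum_insert (by simp)]
  have h1 := hsplit (x - 1) (by omega)
  have h2 := hsplit (x - 2) (by omega)
  rw [sub_add_cancel] at h1
  rw [show x - 2 + 1 = x - 1 by ring] at h2
  rw [integral_stepMeasure, h2, h1, hsplit x hx]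
  simp only [smul_eq_mul]
  linear_combination (h x + ∑ j ∈ Finset.Ico (x + 1) n, h j) * prob_sum (ω x) - hh.eq x

theorem IsMeanPassageTime.ae_exists_hitBy {ω : Env} {h : ℤ → ℝ} (hh : IsMeanPassageTime ω h)
    {n : ℤ} (hn : 0 < n) : ∀ᵐ X ∂quenchedLaw ω, ∃ t, HitBy n t X := by
  refine ae_exists_hitBy_of_drift (f := fun x => ENNReal.ofReal (∑ j ∈ Finset.Ico x n, h j)) hn
    ENNReal.ofReal_ne_top fun x hx => ?_
  have hnonneg : ∀ z, 0 ≤ ∑ j ∈ Finset.Ico z n, h j := fun z =>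
    Finset.sum_nonneg fun j _ => hh.nonneg j
  rw [← ofReal_integral_eq_lintegral_ofReal (integrable_stepMeasure ω x _) (ae_of_all _ hnonneg),
    ← ENNReal.ofReal_one, ← ENNReal.ofReal_add zero_le_one (integral_nonneg hnonneg),
    hh.one_add_integral hx]

/-! ### Multiplicative functionals of the path up to a hitting time -/

@[to_additive]
theorem FirstHit.prod_range_ite_hitBy {M : Type*} [CommMonoid M] {n : ℤ} {t T : ℕ} {X : ℕ → ℤ}
    (h : FirstHit n T X) (hTt : T ≤ t) (c : ℕ → M) :
    ∏ k ∈ Finset.range t, (if HitBy n k X then 1 else c k) = ∏ k ∈ Finset.range T, c k := by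
  rw [← Finset.prod_range_mul_prod_Ico _ hTt,
    Finset.prod_congr rfl fun k hk => if_neg (by rw [h.hitBy_iff, not_le]; simpa using hk),
    Finset.prod_eq_one fun k hk => if_pos (h.hitBy_iff.2 (Finset.mem_Ico.1 hk).1), mul_one]

/-- The product of the weights `w` of the steps made up to time `t`, or up to the first visit to
`n` if this comes earlier. -/
def stoppedWeight (w : ℤ → ℤ → ℂ) (n : ℤ) (t : ℕ) (X : ℕ → ℤ) : ℂ :=
  ∏ k ∈ Finset.range t, if HitBy n k X then 1 else w (X k) (X (k + 1))

/-- The stopped weight times the value of `V` at the current position; after the visit to `n` this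
value is frozen at `1`, which is `V n` in the application. -/
def stoppedWeightMul (w : ℤ → ℤ → ℂ) (V : ℤ → ℂ) (n : ℤ) (t : ℕ) (X : ℕ → ℤ) : ℂ :=
  stoppedWeight w n t X * if HitBy n t X then 1 else V (X t)

section Weight

variable {w : ℤ → ℤ → ℂ} {V : ℤ → ℂ} {n : ℤ} {ω : Env}

theorem norm_stoppedWeight_mul_ite_le_one (hw : ∀ x y, ‖w x y‖ ≤ 1) (t : ℕ) (X : ℕ → ℤ) {c : ℂ}
    (hc : ‖c‖ ≤ 1) : ‖stoppedWeight w n t X * if HitBy n t X then 1 else c‖ ≤ 1 := by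
  rw [stoppedWeight, norm_mul, norm_prod]
  refine mul_le_one₀ (Finset.prod_le_one (fun _ _ => norm_nonneg _) fun k _ => ?_)
    (norm_nonneg _) ?_
  · split_ifs
    exacts [norm_one.le, hw _ _]
  · split_ifs
    exacts [norm_one.le, hc]

theorem dependsOn_stoppedWeight (w : ℤ → ℤ → ℂ) (n : ℤ) (t : ℕ) :
    DependsOn (stoppedWeight w n t) (Set.Iic t) := fun X Y h =>
  Finset.prod_congr rfl fun k hk => by
    have hkt : k + 1 ≤ t := Finset.mem_range.1 hk
    simp only [dependsOn_hitBy n (Nat.le_of_succ_le hkt) h, h k (Nat.le_of_succ_le hkt),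
      h (k + 1) hkt]

theorem dependsOn_stoppedWeightMul (w : ℤ → ℤ → ℂ) (V : ℤ → ℂ) (n : ℤ) (t : ℕ) :
    DependsOn (stoppedWeightMul w V n t) (Set.Iic t) := fun X Y h => by
  simp only [stoppedWeightMul, dependsOn_stoppedWeight w n t h, dependsOn_hitBy n le_rfl h,
    h t Set.self_mem_Iic]

theorem stoppedWeightMul_succ (hVn : V n = 1) (t : ℕ) (X : ℕ → ℤ) :
    stoppedWeightMul w V n (t + 1) X = stoppedWeight w n t X *
      if HitBy n t X then 1 else w (X t) (X (t + 1)) * V (X (t + 1)) := by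
  simp only [stoppedWeightMul, stoppedWeight, Finset.prod_range_succ, hitBy_succ, mul_assoc]
  by_cases hhit : HitBy n t X
  · simp [hhit]
  · by_cases hnext : X (t + 1) = n <;> simp [hhit, hnext, hVn]

theorem integral_stoppedWeightMul_succ (hn : 0 < n) (hw : ∀ x y, ‖w x y‖ ≤ 1)
    (hV : ∀ x, ‖V x‖ ≤ 1) (hVn : V n = 1)
    (hharm : ∀ x < n, ∫ y, w x y * V y ∂stepMeasure ω x = V x) (t : ℕ) :
    ∫ X, stoppedWeightMul w V n (t + 1) X ∂quenchedLaw ω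
      = ∫ X, stoppedWeightMul w V n t X ∂quenchedLaw ω := by
  have hwV : ∀ x y, ‖w x y * V y‖ ≤ 1 := fun x y => by
    rw [norm_mul]
    exact mul_le_one₀ (hw x y) (norm_nonneg _) (hV y)
  simp_rw [stoppedWeightMul_succ hVn]
  rw [integral_quenchedLaw_succ ω
    (F := fun X z => stoppedWeight w n t X * if HitBy n t X then 1 else w (X t) z * V z)
    (fun X Y h => by simp only [dependsOn_stoppedWeight w n t h, dependsOn_hitBy n le_rfl h,
      h t Set.self_mem_Iic])
    fun X z => norm_stoppedWeight_mul_ite_le_one hw t X (hwV _ _)]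
  refine integral_congr_ae ?_
  filter_upwards [ae_isWalk ω] with X hX
  rw [integral_const_mul, stoppedWeightMul]
  by_cases hhit : HitBy n t X
  · simp [hhit]
  · simp only [hhit, if_false, hharm _ (hX.lt_of_not_hitBy hn hhit)]

theorem integral_stoppedWeightMul (hn : 0 < n) (hw : ∀ x y, ‖w x y‖ ≤ 1)
    (hV : ∀ x, ‖V x‖ ≤ 1) (hVn : V n = 1)
    (hharm : ∀ x < n, ∫ y, w x y * V y ∂stepMeasure ω x = V x) (t : ℕ) :
    ∫ X, stoppedWeightMul w V n t X ∂quenchedLaw ω = V 0 := by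
  induction t with
  | zero =>
    have hstart : ∀ᵐ X ∂quenchedLaw ω, stoppedWeightMul w V n 0 X = V 0 := by
      filter_upwards [ae_quenchedLaw_zero ω] with X hX
      simp [stoppedWeightMul, stoppedWeight, HitBy, hX, hn.ne]
    simp [integral_congr_ae hstart]
  | succ t ih => rw [integral_stoppedWeightMul_succ hn hw hV hVn hharm, ih]

/-- Optional stopping: the stopped weight times `V` is a bounded martingale which eventually equals
`G`. -/
theorem integral_eq_of_harmonic (hn : 0 < n) (hhit : ∀ᵐ X ∂quenchedLaw ω, ∃ t, HitBy n t X)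
    (hw : ∀ x y, ‖w x y‖ ≤ 1) (hV : ∀ x, ‖V x‖ ≤ 1) (hVn : V n = 1)
    (hharm : ∀ x < n, ∫ y, w x y * V y ∂stepMeasure ω x = V x) {G : (ℕ → ℤ) → ℂ}
    (hG : ∀ X, IsWalk X → ∀ T, FirstHit n T X →
      G X = ∏ k ∈ Finset.range T, w (X k) (X (k + 1))) :
    ∫ X, G X ∂quenchedLaw ω = V 0 := by
  have hlim : ∀ᵐ X ∂quenchedLaw ω,
      Tendsto (fun t => stoppedWeightMul w V n t X) atTop (𝓝 (G X)) := by
    filter_upwards [ae_isWalk ω, hhit] with X hX hhitX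
    obtain ⟨T, hT⟩ := exists_firstHit hhitX
    refine tendsto_const_nhds.congr' ?_
    filter_upwards [eventually_ge_atTop T] with t ht
    rw [hG X hX T hT, stoppedWeightMul, stoppedWeight, hT.prod_range_ite_hitBy ht,
      if_pos (hT.hitBy_iff.2 ht), mul_one]
  have hconv := tendsto_integral_of_dominated_convergence (fun _ => (1 : ℝ))
    (fun t => (measurable_of_dependsOn_Iic
      (dependsOn_stoppedWeightMul w V n t)).aestronglyMeasurable) (integrable_const 1)
    (fun t => ae_of_all _ fun X => norm_stoppedWeight_mul_ite_le_one hw t X (hV _)) hlim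
  simp_rw [integral_stoppedWeightMul hn hw hV hVn hharm] at hconv
  exact tendsto_nhds_unique hconv tendsto_const_nhds

end Weight

/-! ### Jump counts as sums over the steps of the path -/

/-- The contribution of one step from `x` to `y` to the jump counts of the site `i`. -/
def stepCount (i x y : ℤ) : Fin 3 → ℕ :=
  ![if i = x ∧ y = x - 1 then 1 else 0, if i = x ∧ y = x - 2 then 1 else 0,
    if i = x - 1 ∧ y = x - 2 then 1 else 0]

theorem ncard_setOf_step {X : ℕ → ℤ} {T : ℕ} {a b : ℤ}
    (hlast : ∀ k, k + 1 = T → ¬ (X k = a ∧ X (k + 1) = b)) :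
    {k : ℕ | 0 < k ∧ (k : ℕ∞) < T ∧ X (k - 1) = a ∧ X k = b}.ncard
      = ∑ k ∈ Finset.range T, if X k = a ∧ X (k + 1) = b then 1 else 0 := by
  rw [← Finset.card_filter, ← Finset.card_image_of_injective _ Nat.succ_injective,
    ← Set.ncard_coe_finset]
  congr 1
  ext k
  simp only [Set.mem_ofPred_eq, Nat.cast_lt, Finset.coe_image, Finset.coe_filter, Finset.mem_range,
    Set.mem_image]
  constructor
  · rintro ⟨hpos, hkT, hstep⟩
    obtain ⟨l, rfl⟩ := Nat.exists_eq_succ_of_ne_zero hpos.ne'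
    exact ⟨l, ⟨by omega, hstep⟩, rfl⟩
  · rintro ⟨l, ⟨hlT, hstep⟩, rfl⟩
    exact ⟨l.succ_pos, lt_of_le_of_ne hlT fun hl => hlast l hl hstep, hstep⟩

section FirstHit

variable {n : ℤ} {T : ℕ} {X : ℕ → ℤ}

theorem FirstHit.jumpCount_eq (h : FirstHit n T X) (hX : IsWalk X) (hn : 0 < n) (i : ℤ) :
    jumpCount n i X = ∑ k ∈ Finset.range T, stepCount i (X k) (X (k + 1)) := by
  have hlast : ∀ k, k + 1 = T → X (k + 1) = X k + 1 := fun k hk => by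
    have hlt := h.lt hX hn (show k < T by omega)
    have hXT := h.1
    rw [← hk] at hXT
    rcases hX.2 k with hstep | hstep | hstep <;> omega
  rw [jumpCount, h.hittingTime_eq (h.pos hX hn)]
  funext σ
  rw [Finset.sum_apply]
  fin_cases σ <;>
    exact (ncard_setOf_step fun k hk => by have := hlast k hk; omega).trans
      (Finset.sum_congr rfl fun k _ => if_congr (by omega) rfl rfl)

theorem FirstHit.jumpCount_self (h : FirstHit n T X) (hX : IsWalk X) (hn : 0 < n) :
    jumpCount n n X = 0 := by
  rw [h.jumpCount_eq hX hn]
  refine Finset.sum_eq_zero fun k hk => ?_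
  have hlt := h.lt hX hn (Finset.mem_range.1 hk)
  have hne : n ≠ X k := hlt.ne'
  have hne' : n ≠ X k - 1 := by omega
  simp [stepCount, hne, hne']

theorem aemeasurable_jumpCount {ω : Env} (hn : 0 < n)
    (hhit : ∀ᵐ X ∂quenchedLaw ω, ∃ t, HitBy n t X) (i : ℤ) :
    AEMeasurable (jumpCount n i) (quenchedLaw ω) := by
  refine aemeasurable_of_tendsto_metrizable_ae (u := atTop) (f := fun t X =>
    ∑ k ∈ Finset.range t, if HitBy n k X then 0 else stepCount i (X k) (X (k + 1)))
    (fun t => (measurable_of_dependsOn_Iic (t := t) fun X Y h => ?_).aemeasurable) ?_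
  · refine Finset.sum_congr rfl fun k hk => ?_
    have hkt : k + 1 ≤ t := Finset.mem_range.1 hk
    simp only [dependsOn_hitBy n (Nat.le_of_succ_le hkt) h, h k (Nat.le_of_succ_le hkt),
      h (k + 1) hkt]
  · filter_upwards [ae_isWalk ω, hhit] with X hX hhitX
    obtain ⟨T, hT⟩ := exists_firstHit hhitX
    refine tendsto_const_nhds.congr' ?_
    filter_upwards [eventually_ge_atTop T] with t ht
    rw [hT.jumpCount_eq hX hn, hT.sum_range_ite_hitBy ht]

end FirstHit

/-! ### The hitting time in terms of the jump counts -/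

/-- The total contribution of a step from `x` to `y` to the weighted sum of the jump counts, in
which jumps counted in the three coordinates have weights `2, 1, 2`. A jump by `-2` is counted at
two sites. -/
def stepCost (x y : ℤ) : ℕ := if y = x - 1 then 2 else if y = x - 2 then 3 else 0

theorem hasSum_ite_coe_eq {s : Set ℤ} {x : ℤ} (hx : x ∈ s) (P : Prop) [Decidable P] (c : ℕ) :
    HasSum (fun k : s => if (k : ℤ) = x ∧ P then c else 0) (if P then c else 0) := by
  have hsingle := hasSum_single (f := fun k : s => if (k : ℤ) = x ∧ P then c else 0) ⟨x, hx⟩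
    fun k hk => if_neg fun h => hk (Subtype.ext h.1)
  simpa using hsingle

theorem hasSum_stepCount_dotProduct {a x : ℤ} (hx : x ≤ a) (y : ℤ) :
    HasSum (fun k : Set.Iic a => stepCount k x y ⬝ᵥ ![2, 1, 2]) (stepCost x y) := by
  have hx' : x - 1 ∈ Set.Iic a := Set.mem_Iic.2 (by omega)
  have hsum := ((hasSum_ite_coe_eq (s := Set.Iic a) hx (y = x - 1) 2).add
    (hasSum_ite_coe_eq (s := Set.Iic a) hx (y = x - 2) 1)).add
    (hasSum_ite_coe_eq hx' (y = x - 2) 2)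
  convert hsum using 1
  · funext k
    simp [stepCount, dotProduct, Fin.sum_univ_three]
  · unfold stepCost
    split_ifs <;> omega

theorem IsWalk.sub_add_stepCost {X : ℕ → ℤ} (hX : IsWalk X) (t : ℕ) :
    X (t + 1) - X t + stepCost (X t) (X (t + 1)) = 1 := by
  unfold stepCost
  rcases hX.2 t with h | h | h <;> split_ifs <;> omega

theorem FirstHit.eq_add_sum_stepCost {n T : ℕ} {X : ℕ → ℤ} (h : FirstHit n T X) (hX : IsWalk X) :
    T = n + ∑ t ∈ Finset.range T, stepCost (X t) (X (t + 1)) := by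
  have hsum : (T : ℤ) = n + ∑ t ∈ Finset.range T, (stepCost (X t) (X (t + 1)) : ℤ) := by
    calc (T : ℤ) = ∑ t ∈ Finset.range T, (X (t + 1) - X t + stepCost (X t) (X (t + 1))) := by
          simp [hX.sub_add_stepCost]
      _ = _ := by rw [Finset.sum_add_distrib, Finset.sum_range_sub, h.1, hX.1, sub_zero]
  exact_mod_cast hsum

theorem FirstHit.exists_hasSum_jumpCount {n T : ℕ} {X : ℕ → ℤ} (h : FirstHit n T X)
    (hX : IsWalk X) (hn : 0 < n) : ∃ s : ℕ,
      HasSum (fun k : Set.Iic ((n : ℤ) - 1) => jumpCount n k X ⬝ᵥ ![2, 1, 2]) s ∧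
      hittingTime n X = n + s := by
  have hn' : (0 : ℤ) < n := by exact_mod_cast hn
  refine ⟨∑ t ∈ Finset.range T, stepCost (X t) (X (t + 1)), ?_, ?_⟩
  · simp_rw [h.jumpCount_eq hX hn', sum_dotProduct]
    exact hasSum_sum fun t ht => hasSum_stepCount_dotProduct
      (Int.le_sub_one_of_lt (h.lt hX hn' (Finset.mem_range.1 ht))) _
  · rw [h.hittingTime_eq (h.pos hX hn')]
    exact_mod_cast h.eq_add_sum_stepCost hX

/-! ### Products of weights over the steps -/

/-- The weight of a step from `x` to `y` when each jump counted at a site `i` is weighted by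
`u i`. -/
noncomputable def stepWeight (u : ℤ → Fin 3 → ℂ) (x y : ℤ) : ℂ :=
  (if y = x - 1 then u x 0 else 1) * (if y = x - 2 then u x 1 else 1)
    * if y = x - 2 then u (x - 1) 2 else 1

section StepWeight

variable {u : ℤ → Fin 3 → ℂ}

theorem norm_stepWeight_le_one (hu : ∀ i σ, ‖u i σ‖ ≤ 1) (x y : ℤ) : ‖stepWeight u x y‖ ≤ 1 := by
  rw [stepWeight, norm_mul, norm_mul]
  refine mul_le_one₀ (mul_le_one₀ ?_ (norm_nonneg _) ?_) (norm_nonneg _) ?_ <;>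
    split_ifs <;> simp [hu]

theorem prod_pow_ite_eq {M : Type*} [CommMonoid M] {S : Finset ℤ} {g : ℤ → M}
    (hg : ∀ i ∉ S, g i = 1) (x : ℤ) (P : Prop) [Decidable P] :
    ∏ i ∈ S, g i ^ (if i = x ∧ P then 1 else 0) = if P then g x else 1 := by
  by_cases hP : P
  · simp only [hP, and_true, if_true]
    rw [Finset.prod_eq_single x (fun i _ hi => by simp [hi]) fun hx => by simp [hg x hx]]
    simp
  · simp [hP]

theorem prod_pow_stepCount {S : Finset ℤ} (hu : ∀ i ∉ S, u i = 1) (x y : ℤ) :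
    ∏ i ∈ S, ∏ σ, u i σ ^ stepCount i x y σ = stepWeight u x y := by
  have hσ : ∀ σ, ∀ i ∉ S, u i σ = 1 := fun σ i hi => by rw [hu i hi, Pi.one_apply]
  simp_rw [Fin.prod_univ_three, Finset.prod_mul_distrib]
  exact congrArg₂ _ (congrArg₂ _ (prod_pow_ite_eq (hσ 0) x _) (prod_pow_ite_eq (hσ 1) x _))
    (prod_pow_ite_eq (hσ 2) (x - 1) _)

theorem FirstHit.prod_pow_jumpCount {n : ℤ} {T : ℕ} {X : ℕ → ℤ} {S : Finset ℤ}
    (h : FirstHit n T X) (hX : IsWalk X) (hn : 0 < n) (hu : ∀ i ∉ S, u i = 1) :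
    ∏ i ∈ S, ∏ σ, u i σ ^ jumpCount n i X σ
      = ∏ k ∈ Finset.range T, stepWeight u (X k) (X (k + 1)) := by
  simp_rw [h.jumpCount_eq hX hn, Finset.sum_apply, ← Finset.prod_pow_eq_pow_sum,
    Finset.prod_comm (s := Finset.univ) (t := Finset.range T)]
  rw [Finset.prod_comm]
  exact Finset.prod_congr rfl fun k _ => prod_pow_stepCount hu _ _

end StepWeight

/-! ### Generating functions of the offspring laws -/

theorem sum_antidiagonal_choose_mul_pow {R : Type*} [CommSemiring R] (a b : R) (N : ℕ) :
    ∑ v ∈ Finset.HasAntidiagonal.antidiagonal N,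
      ((v.1 + v.2).choose v.1 : R) * (a ^ v.1 * b ^ v.2) = (a + b) ^ N := by
  rw [(Commute.all a b).add_pow']
  refine Finset.sum_congr rfl fun v hv => ?_
  rw [nsmul_eq_mul, Finset.HasAntidiagonal.mem_antidiagonal.1 hv]

theorem summable_choose_mul_pow {a b : ℝ} (ha : 0 ≤ a) (hb : 0 ≤ b) (hab : a + b < 1) :
    Summable fun v : ℕ × ℕ => ((v.1 + v.2).choose v.1 : ℝ) * (a ^ v.1 * b ^ v.2) := by
  rw [← (Finset.HasAntidiagonal.sigmaAntidiagonalEquivProd (A := ℕ)).summable_iff,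
    summable_sigma_of_nonneg fun _ => by simp only [Function.comp_apply]; positivity]
  refine ⟨fun _ => Summable.of_finite, ?_⟩
  refine (summable_geometric_of_lt_one (add_nonneg ha hb) hab).congr fun N => ?_
  rw [tsum_fintype, ← sum_antidiagonal_choose_mul_pow]
  exact (Finset.sum_coe_sort (Finset.HasAntidiagonal.antidiagonal N) fun v =>
    ((v.1 + v.2).choose v.1 : ℝ) * (a ^ v.1 * b ^ v.2)).symm

theorem hasSum_choose_mul_pow {𝕜 : Type*} [NormedField 𝕜] [CompleteSpace 𝕜] {a b : 𝕜}
    (hab : ‖a‖ + ‖b‖ < 1) :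
    HasSum (fun v : ℕ × ℕ => ((v.1 + v.2).choose v.1 : 𝕜) * (a ^ v.1 * b ^ v.2))
      (1 - (a + b))⁻¹ := by
  have hsum : Summable fun v : ℕ × ℕ => ((v.1 + v.2).choose v.1 : 𝕜) * (a ^ v.1 * b ^ v.2) := by
    refine .of_norm_bounded (summable_choose_mul_pow (norm_nonneg a) (norm_nonneg b) hab)
      fun v => ?_
    rw [norm_mul, norm_mul, norm_pow, norm_pow]
    gcongr
    simpa using Nat.norm_cast_le (α := 𝕜) ((v.1 + v.2).choose v.1)
  have hsigma := (Finset.HasAntidiagonal.sigmaAntidiagonalEquivProd (A := ℕ)).summable_iff.2 hsum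
  simp only [Function.comp_def] at hsigma
  rw [hsum.hasSum_iff, ← tsum_geometric_of_norm_lt_one ((norm_add_le a b).trans_lt hab),
    ← (Finset.HasAntidiagonal.sigmaAntidiagonalEquivProd (A := ℕ)).tsum_eq,
    Summable.tsum_sigma' (fun _ => Summable.of_finite) hsigma]
  refine tsum_congr fun N => ?_
  rw [tsum_fintype, ← sum_antidiagonal_choose_mul_pow]
  exact Finset.sum_coe_sort (Finset.HasAntidiagonal.antidiagonal N) fun v =>
    ((v.1 + v.2).choose v.1 : 𝕜) * (a ^ v.1 * b ^ v.2)

theorem norm_prod_pow_le_one {ι 𝕜 : Type*} [Fintype ι] [NormedField 𝕜] {x : ι → 𝕜}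
    (hx : ∀ i, ‖x i‖ ≤ 1) (v : ι → ℕ) : ‖∏ i, x i ^ v i‖ ≤ 1 := by
  rw [norm_prod]
  refine Finset.prod_le_one (fun _ _ => norm_nonneg _) fun i _ => ?_
  rw [norm_pow]
  exact pow_le_one₀ (norm_nonneg _) (hx i)

theorem norm_mul_le_one {𝕜 : Type*} [NormedField 𝕜] {a b : 𝕜} (ha : ‖a‖ ≤ 1) (hb : ‖b‖ ≤ 1) :
    ‖a * b‖ ≤ 1 := by
  rw [norm_mul]
  exact mul_le_one₀ ha (norm_nonneg _) hb

/-- The generating function `E[x ^ a * y ^ b]` of the law `pairLaw p` of `(a, b)`. -/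
noncomputable def pairGF (p : StepLaw) (x y : ℂ) : ℂ :=
  prob p 1 / (1 - (prob p (-1) * x + prob p (-2) * y))

section PairGF

variable {p : StepLaw} {x y : ℂ}

theorem prob_add_prob_lt_one (hp : 0 < prob p 1) : prob p (-1) + prob p (-2) < 1 := by
  linarith [prob_sum p]

theorem norm_prob_mul_le (p : StepLaw) (l : ℤ) (hx : ‖x‖ ≤ 1) : ‖prob p l * x‖ ≤ prob p l := by
  rw [norm_mul, Complex.norm_real, Real.norm_of_nonneg (prob_nonneg p l)]
  exact mul_le_of_le_one_right (prob_nonneg p l) hx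

theorem prob_one_le_norm_one_sub (p : StepLaw) (hx : ‖x‖ ≤ 1) (hy : ‖y‖ ≤ 1) :
    prob p 1 ≤ ‖1 - (prob p (-1) * x + prob p (-2) * y)‖ := by
  have htri := norm_sub_norm_le (1 : ℂ) (prob p (-1) * x + prob p (-2) * y)
  rw [norm_one] at htri
  linarith [norm_add_le (prob p (-1) * x) (prob p (-2) * y), norm_prob_mul_le p (-1) hx,
    norm_prob_mul_le p (-2) hy, prob_sum p]

theorem norm_pairGF_le_one (p : StepLaw) (hx : ‖x‖ ≤ 1) (hy : ‖y‖ ≤ 1) : ‖pairGF p x y‖ ≤ 1 := by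
  rw [pairGF, norm_div, Complex.norm_real, Real.norm_of_nonneg (prob_nonneg p 1)]
  exact div_le_one_of_le₀ (prob_one_le_norm_one_sub p hx hy) (norm_nonneg _)

theorem pairGF_eq_add (hp : 0 < prob p 1) (hx : ‖x‖ ≤ 1) (hy : ‖y‖ ≤ 1) :
    pairGF p x y = prob p 1 + (prob p (-1) * x + prob p (-2) * y) * pairGF p x y := by
  have hne : 1 - (prob p (-1) * x + prob p (-2) * y) ≠ 0 :=
    norm_pos_iff.1 (hp.trans_le (prob_one_le_norm_one_sub p hx hy))
  have hmul : pairGF p x y * (1 - (prob p (-1) * x + prob p (-2) * y)) = prob p 1 :=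
    div_mul_cancel₀ _ hne
  linear_combination hmul

theorem pairGF_one_one (hp : 0 < prob p 1) : pairGF p 1 1 = 1 := by
  have hsum : (prob p (-2) : ℂ) + prob p (-1) + prob p 1 = 1 := by exact_mod_cast prob_sum p
  rw [pairGF, show (1 : ℂ) - (prob p (-1) * 1 + prob p (-2) * 1) = prob p 1 by
    linear_combination -hsum]
  exact div_self (by exact_mod_cast hp.ne')

theorem pairLaw_apply (hp : 0 < prob p 1) (v : ℕ × ℕ) :
    pairLaw p v = ENNReal.ofReal (pairMass p v) := by
  have hlaw : pairLaw p = ⟨fun v => ENNReal.ofReal (pairMass p v), hasSum_pairMass p hp⟩ :=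
    dif_pos hp
  rw [hlaw]
  rfl

theorem pairMass_eq_choose (p : StepLaw) (v : ℕ × ℕ) : pairMass p v
    = (v.1 + v.2).choose v.1 * (prob p (-1) ^ v.1 * prob p (-2) ^ v.2) * prob p 1 := by
  rw [pairMass, Nat.cast_add_choose, mul_assoc (_ / _)]

theorem integral_pairLaw (hp : 0 < prob p 1) (hx : ‖x‖ ≤ 1) (hy : ‖y‖ ≤ 1) :
    ∫ v, x ^ v.1 * y ^ v.2 ∂(pairLaw p).toMeasure = pairGF p x y := by
  have hlt : ‖prob p (-1) * x‖ + ‖prob p (-2) * y‖ < 1 :=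
    (add_le_add (norm_prob_mul_le p _ hx) (norm_prob_mul_le p _ hy)).trans_lt
      (prob_add_prob_lt_one hp)
  rw [PMF.integral_eq_tsum, pairGF, div_eq_inv_mul, ← (hasSum_choose_mul_pow hlt).tsum_eq,
    ← tsum_mul_right]
  · refine tsum_congr fun v => ?_
    rw [pairLaw_apply hp, ENNReal.toReal_ofReal (pairMass_nonneg p v), pairMass_eq_choose,
      Complex.real_smul]
    push_cast
    ring
  · exact .of_bound (measurable_of_countable _).aestronglyMeasurable 1 (ae_of_all _ fun v => by
      simpa using norm_prod_pow_le_one (x := ![x, y]) (by simp [Fin.forall_fin_two, hx, hy])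
        ![v.1, v.2])

end PairGF

theorem integral_offspringLaw {p : StepLaw} (hp : 0 < prob p 1) (τ : Fin 3) {x : Fin 3 → ℂ}
    (hx : ∀ σ, ‖x σ‖ ≤ 1) :
    ∫ v, ∏ σ, x σ ^ v σ ∂(offspringLaw p τ).toMeasure
      = pairGF p (x 0) (x 1) * if τ = 1 then x 2 else 1 := by
  rw [offspringLaw, ← PMF.toMeasure_map _ _ (measurable_of_countable _),
    integral_map (measurable_of_countable _).aemeasurable
      (measurable_of_countable _).aestronglyMeasurable,
    ← integral_pairLaw hp (hx 0) (hx 1), ← integral_mul_const]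
  refine integral_congr_ae (ae_of_all _ fun v => ?_)
  simp only [Fin.prod_univ_three]
  split_ifs <;> simp

theorem offspringLaw_apply {p : StepLaw} (hp : 0 < prob p 1) (τ : Fin 3) (a b : ℕ) :
    offspringLaw p τ ![a, b, if τ = 1 then 1 else 0] = ENNReal.ofReal (pairMass p (a, b)) := by
  rw [offspringLaw, PMF.map_apply, tsum_eq_single (a, b), if_pos rfl, pairLaw_apply hp]
  exact fun v hv => if_neg fun h => hv (Prod.ext (congrFun h 0).symm (congrFun h 1).symm)

/-! ### Generating functions of the branching process -/

theorem integral_comp_eq_integral_integral_of_indepFun {Ω α β E : Type*} [MeasurableSpace Ω]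
    [MeasurableSpace α] [Countable α] [MeasurableSingletonClass α] [MeasurableSpace β]
    [NormedAddCommGroup E] [NormedSpace ℝ E] [MeasurableSpace E] [BorelSpace E]
    [SecondCountableTopology E] {μ : Measure Ω} [IsProbabilityMeasure μ] {X : Ω → α} {Y : Ω → β}
    (hX : Measurable X) (hY : Measurable Y) (hXY : IndepFun X Y μ) {F : α → β → E} {C : ℝ}
    (hF : ∀ a, Measurable (F a)) (hC : ∀ a b, ‖F a b‖ ≤ C) :
    ∫ ω, F (X ω) (Y ω) ∂μ = ∫ ω, ∫ ω', F (X ω) (Y ω') ∂μ ∂μ := by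
  have hFm : Measurable fun z : α × β => F z.1 z.2 := measurable_from_prod_countable_right hF
  have := Measure.isProbabilityMeasure_map (μ := μ) hX.aemeasurable
  have := Measure.isProbabilityMeasure_map (μ := μ) hY.aemeasurable
  calc ∫ ω, F (X ω) (Y ω) ∂μ
      = ∫ z, F z.1 z.2 ∂(μ.map X).prod (μ.map Y) := by
        rw [← (indepFun_iff_map_prod_eq_prod_map_map hX.aemeasurable hY.aemeasurable).1 hXY,
          integral_map (hX.prodMk hY).aemeasurable hFm.aestronglyMeasurable]
    _ = ∫ a, ∫ b, F a b ∂μ.map Y ∂μ.map X :=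
        integral_prod _ (.of_bound hFm.aestronglyMeasurable C (ae_of_all _ fun z => hC z.1 z.2))
    _ = ∫ ω, ∫ b, F (X ω) b ∂μ.map Y ∂μ :=
        integral_map hX.aemeasurable
          (hFm.stronglyMeasurable.integral_prod_right').aestronglyMeasurable
    _ = ∫ ω, ∫ ω', F (X ω) (Y ω') ∂μ ∂μ :=
        integral_congr_ae (ae_of_all _ fun ω =>
          integral_map hY.aemeasurable (hF (X ω)).aestronglyMeasurable)

/-- The numbers of individuals of each type that reproduce in a generation with population `z`:
one immigrant of the first type is added. -/
def parents (z : Fin 3 → ℕ) (τ : Fin 3) : ℕ := if τ = 0 then 1 + z 0 else z τ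

theorem prod_pow_parents {R : Type*} [CommMonoid R] (x : Fin 3 → R) (z : Fin 3 → ℕ) :
    ∏ τ, x τ ^ parents z τ = x 0 * ∏ τ, x τ ^ z τ := by
  simp [Fin.prod_univ_three, parents, pow_add, mul_assoc]

theorem generation_succ (ξ : ℕ × Fin 3 × ℕ → Fin 3 → ℕ) (m : ℕ) :
    generation ξ (m + 1)
      = ∑ τ, ∑ j ∈ Finset.range (parents (generation ξ m) τ), ξ (m, τ, j) := by
  rw [Fin.sum_univ_three]
  rfl

theorem dependsOn_generation (m : ℕ) : DependsOn (fun ξ => generation ξ m) {r | r.1 < m} := by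
  intro ξ η h
  induction m with
  | zero => rfl
  | succ m ih =>
    dsimp only at ih ⊢
    rw [generation_succ, generation_succ, ih fun r hr => h r (Nat.lt_succ_of_lt hr)]
    exact Finset.sum_congr rfl fun τ _ => Finset.sum_congr rfl fun j _ => h _ m.lt_succ_self

theorem prod_pow_generation_succ {R : Type*} [CommMonoid R] (x : Fin 3 → R)
    (ξ : ℕ × Fin 3 × ℕ → Fin 3 → ℕ) (m : ℕ) :
    ∏ σ, x σ ^ generation ξ (m + 1) σ
      = ∏ τ, ∏ j ∈ Finset.range (parents (generation ξ m) τ), ∏ σ, x σ ^ ξ (m, τ, j) σ := by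
  simp_rw [generation_succ, Finset.sum_apply, ← Finset.prod_pow_eq_pow_sum]
  rw [Finset.prod_comm]
  exact Finset.prod_congr rfl fun τ _ => Finset.prod_comm

theorem measurable_generation_le (m : ℕ) :
    Measurable fun (ξ : ℕ × Fin 3 × ℕ → Fin 3 → ℕ) (k : Fin (m + 1)) => generation ξ k :=
  measurable_pi_lambda _ fun k => (measurable_pi_apply (k : ℕ)).comp measurable_generation

section Branching

variable (q : ℕ → Fin 3 → PMF (Fin 3 → ℕ))

/-- The joint law of the offspring variables that drive `branchingLaw q`. -/
noncomputable def offspringField : Measure (ℕ × Fin 3 × ℕ → Fin 3 → ℕ) :=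
  Measure.infinitePi fun k => (q k.1 k.2.1).toMeasure

instance isProbabilityMeasure_offspringField : IsProbabilityMeasure (offspringField q) := by
  unfold offspringField
  infer_instance

theorem indepFun_generation (m : ℕ) :
    IndepFun (fun ξ (k : Fin (m + 1)) => generation ξ k) (fun ξ (r : Fin 3 × ℕ) => ξ (m, r))
      (offspringField q) := by
  refine indepFun_infinitePi_of_dependsOn (s := {r | r.1 < m}) (t := {r | r.1 = m}) _
    (measurable_generation_le m) (by fun_prop) (fun ξ η h => funext fun k => ?_)
    (fun ξ η h => funext fun r => h (m, r) rfl)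
    (Set.disjoint_left.2 fun r hlt heq => hlt.ne heq)
  exact dependsOn_generation k fun r hr => h r (hr.trans_le (Nat.lt_succ_iff.1 k.2))

theorem integral_prod_offspring (m : ℕ) (N : Fin 3 → ℕ) (f : (Fin 3 → ℕ) → ℂ) :
    ∫ ξ, ∏ τ, ∏ j ∈ Finset.range (N τ), f (ξ (m, τ, j)) ∂offspringField q
      = ∏ τ, (∫ v, f v ∂(q m τ).toMeasure) ^ N τ := by
  let e : (τ : Fin 3) × Fin (N τ) → ℕ × Fin 3 × ℕ := fun r => (m, r.1, r.2)
  have he : Function.Injective e := by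
    rintro ⟨τ, j⟩ ⟨τ', j'⟩ h
    obtain ⟨-, rfl, hj⟩ := by simpa only [e, Prod.mk.injEq] using h
    rw [Fin.ext hj]
  have hf : Measurable f := measurable_of_countable f
  have hindep := (iIndepFun_infinitePi (P := fun k : ℕ × Fin 3 × ℕ => (q k.1 k.2.1).toMeasure)
    (X := fun _ v => v) fun _ => measurable_id).precomp he
  calc ∫ ξ, ∏ τ, ∏ j ∈ Finset.range (N τ), f (ξ (m, τ, j)) ∂offspringField q
      = ∫ ξ, ∏ r, f (ξ (e r)) ∂offspringField q := by
        simp only [Fintype.prod_sigma, Finset.prod_range, e]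
    _ = ∏ r, ∫ ξ, f (ξ (e r)) ∂offspringField q :=
        hindep.integral_fun_prod_comp (fun r => (measurable_pi_apply (e r)).aemeasurable)
          fun _ => hf.aestronglyMeasurable
    _ = ∏ r : (τ : Fin 3) × Fin (N τ), ∫ v, f v ∂(q m r.1).toMeasure := by
        refine Finset.prod_congr rfl fun r _ => ?_
        have hmap : (offspringField q).map (Function.eval (e r)) = (q m r.1).toMeasure :=
          Measure.infinitePi_map_eval _ (e r)
        rw [← hmap, integral_map (measurable_pi_apply (e r)).aemeasurable hf.aestronglyMeasurable]
    _ = ∏ τ, (∫ v, f v ∂(q m τ).toMeasure) ^ N τ := by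
        simp [Fintype.prod_sigma]

theorem integral_mul_prod_offspring (m : ℕ) {K : (Fin (m + 1) → Fin 3 → ℕ) → ℂ}
    (hK : ∀ z, ‖K z‖ ≤ 1) {f : (Fin 3 → ℕ) → ℂ} (hf : ∀ v, ‖f v‖ ≤ 1) :
    ∫ ξ, K (fun k => generation ξ k)
        * ∏ τ, ∏ j ∈ Finset.range (parents (generation ξ m) τ), f (ξ (m, τ, j)) ∂offspringField q
      = ∫ ξ, K (fun k => generation ξ k)
        * ∏ τ, (∫ v, f v ∂(q m τ).toMeasure) ^ parents (generation ξ m) τ ∂offspringField q := by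
  have hfm : Measurable f := measurable_of_countable f
  have hbound : ∀ (z : Fin (m + 1) → Fin 3 → ℕ) (y : Fin 3 × ℕ → Fin 3 → ℕ),
      ‖K z * ∏ τ, ∏ j ∈ Finset.range (parents (z (Fin.last m)) τ), f (y (τ, j))‖ ≤ 1 := by
    refine fun z y => norm_mul_le_one (hK z) ?_
    simp only [norm_prod]
    exact Finset.prod_le_one (fun _ _ => Finset.prod_nonneg fun _ _ => norm_nonneg _) fun _ _ =>
      Finset.prod_le_one (fun _ _ => norm_nonneg _) fun _ _ => hf _
  refine (integral_comp_eq_integral_integral_of_indepFun (measurable_generation_le m) (by fun_prop)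
    (indepFun_generation q m) (fun z => by fun_prop) hbound).trans ?_
  refine integral_congr_ae (ae_of_all _ fun ξ => ?_)
  dsimp only
  rw [integral_const_mul, integral_prod_offspring]
  rfl

/-- `Φ m τ` is the generating function, in the variables `s`, of the descendants after time `m` of
an individual of type `τ` living at time `m`; every immigrant contributes one factor `Φ k 0`. -/
theorem integral_prod_pow_generation {s Φ : ℕ → Fin 3 → ℂ} (hs : ∀ m σ, ‖s m σ‖ ≤ 1)
    (hΦ : ∀ m σ, ‖Φ m σ‖ ≤ 1)
    (hq : ∀ m τ, ∫ v, ∏ σ, (s (m + 1) σ * Φ (m + 1) σ) ^ v σ ∂(q m τ).toMeasure = Φ m τ) (m : ℕ) :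
    ∫ ξ, (∏ k : Fin (m + 1), ∏ σ, s k σ ^ generation ξ k σ) * ∏ σ, Φ m σ ^ generation ξ m σ
      ∂offspringField q = ∏ k ∈ Finset.range m, Φ k 0 := by
  induction m with
  | zero => simp [generation]
  | succ m ih =>
    have hsplit : ∀ ξ, (∏ k : Fin (m + 1 + 1), ∏ σ, s k σ ^ generation ξ k σ)
          * ∏ σ, Φ (m + 1) σ ^ generation ξ (m + 1) σ
        = (∏ k : Fin (m + 1), ∏ σ, s k σ ^ generation ξ k σ)
          * ∏ τ, ∏ j ∈ Finset.range (parents (generation ξ m) τ),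
            ∏ σ, (s (m + 1) σ * Φ (m + 1) σ) ^ ξ (m, τ, j) σ := fun ξ => by
      rw [Fin.prod_univ_castSucc, mul_assoc, ← prod_pow_generation_succ]
      simp only [Fin.val_last, Fin.val_castSucc, mul_pow, Finset.prod_mul_distrib]
    have hpast : ∀ z : Fin (m + 1) → Fin 3 → ℕ,
        ‖∏ k : Fin (m + 1), ∏ σ, s k σ ^ z k σ‖ ≤ 1 := fun z => by
      rw [norm_prod]
      exact Finset.prod_le_one (fun _ _ => norm_nonneg _) fun k _ => norm_prod_pow_le_one (hs k) _
    simp_rw [hsplit]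
    rw [integral_mul_prod_offspring q m hpast (norm_prod_pow_le_one fun σ =>
        norm_mul_le_one (hs _ σ) (hΦ _ σ)), Finset.prod_range_succ, ← ih,
      ← integral_mul_const]
    refine integral_congr_ae (ae_of_all _ fun ξ => ?_)
    simp only [hq m, prod_pow_parents]
    ring

end Branching

/-! ### The common generating function -/

/-- The generating function, with variables `u`, of the progeny of an individual of type `τ` that
reproduces at the site `i`. For `τ = 0` it is also the generating function of the weighted jumps of
the walk during its passage from `i` to `i + 1`. The weights below `0` are all taken to be `1`,
hence the initial value. -/
noncomputable def progenyGF (ω : Env) (u : ℤ → Fin 3 → ℂ) (i : ℤ) (τ : Fin 3) : ℂ :=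
  if i < 0 then 1
  else pairGF (ω i) (u i 0 * progenyGF ω u (i - 1) 0) (u i 1 * progenyGF ω u (i - 1) 1)
    * if τ = 1 then u i 2 * progenyGF ω u (i - 1) 2 else 1
termination_by (i + 1).toNat

section ProgenyGF

variable {ω : Env} {u : ℤ → Fin 3 → ℂ}

theorem progenyGF_of_neg {i : ℤ} (hi : i < 0) : progenyGF ω u i = 1 := by
  funext τ
  rw [progenyGF, if_pos hi, Pi.one_apply]

theorem progenyGF_eq (hω : ∀ x, 0 < prob (ω x) 1) (hu : ∀ i < 0, u i = 1) (i : ℤ) (τ : Fin 3) :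
    progenyGF ω u i τ
      = pairGF (ω i) (u i 0 * progenyGF ω u (i - 1) 0) (u i 1 * progenyGF ω u (i - 1) 1)
        * if τ = 1 then u i 2 * progenyGF ω u (i - 1) 2 else 1 := by
  by_cases hi : i < 0
  · simp [progenyGF_of_neg hi, progenyGF_of_neg (show i - 1 < 0 by omega), hu i hi,
      pairGF_one_one (hω i)]
  · rw [progenyGF, if_neg hi]

theorem norm_progenyGF_le_one (hu : ∀ i σ, ‖u i σ‖ ≤ 1) (i : ℤ) (τ : Fin 3) :
    ‖progenyGF ω u i τ‖ ≤ 1 := by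
  rw [progenyGF]
  split_ifs with hi hτ
  · exact norm_one.le
  · have ih := norm_progenyGF_le_one hu (i - 1)
    exact norm_mul_le_one (norm_pairGF_le_one _ (norm_mul_le_one (hu i 0) (ih 0))
      (norm_mul_le_one (hu i 1) (ih 1))) (norm_mul_le_one (hu i 2) (ih 2))
  · have ih := norm_progenyGF_le_one hu (i - 1)
    rw [mul_one]
    exact norm_pairGF_le_one _ (norm_mul_le_one (hu i 0) (ih 0)) (norm_mul_le_one (hu i 1) (ih 1))
termination_by (i + 1).toNat

theorem progenyGF_two (i : ℤ) : progenyGF ω u i 2 = progenyGF ω u i 0 := by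
  rw [progenyGF, progenyGF.eq_def ω u i 0]
  rfl

theorem progenyGF_one (hω : ∀ x, 0 < prob (ω x) 1) (hu : ∀ i < 0, u i = 1) (i : ℤ) :
    progenyGF ω u i 1 = progenyGF ω u i 0 * (u i 2 * progenyGF ω u (i - 1) 0) := by
  simp [progenyGF_eq hω hu i, progenyGF_two]

theorem progenyGF_zero_eq_add (hω : ∀ x, 0 < prob (ω x) 1) (hu : ∀ i < 0, u i = 1)
    (hu1 : ∀ i σ, ‖u i σ‖ ≤ 1) (i : ℤ) :
    progenyGF ω u i 0 = prob (ω i) 1 + (prob (ω i) (-1) * (u i 0 * progenyGF ω u (i - 1) 0)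
      + prob (ω i) (-2) * (u i 1 * progenyGF ω u (i - 1) 1)) * progenyGF ω u i 0 := by
  have hF := norm_progenyGF_le_one (ω := ω) hu1
  have hzero := progenyGF_eq hω hu i 0
  rw [if_neg (by decide), mul_one] at hzero
  rw [hzero]
  exact pairGF_eq_add (hω i) (norm_mul_le_one (hu1 i 0) (hF (i - 1) 0))
    (norm_mul_le_one (hu1 i 1) (hF (i - 1) 1))

theorem integral_stepWeight_mul_prod_progenyGF (hω : ∀ x, 0 < prob (ω x) 1)
    (hu : ∀ i < 0, u i = 1) (hu1 : ∀ i σ, ‖u i σ‖ ≤ 1) {n x : ℤ} (hx : x < n) :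
    ∫ y, stepWeight u x y * ∏ j ∈ Finset.Ico y n, progenyGF ω u j 0 ∂stepMeasure ω x
      = ∏ j ∈ Finset.Ico x n, progenyGF ω u j 0 := by
  have hleft : ∀ y < n, ∏ j ∈ Finset.Ico y n, progenyGF ω u j 0
      = progenyGF ω u y 0 * ∏ j ∈ Finset.Ico (y + 1) n, progenyGF ω u j 0 := fun y hy => by
    rw [← Finset.insert_Ico_add_one_left_eq_Ico hy, Finset.prod_insert (by simp)]
  have hone := hleft (x - 1) (by omega)
  have htwo := hleft (x - 2) (by omega)
  rw [sub_add_cancel, hleft x hx] at hone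
  rw [show x - 2 + 1 = x - 1 by ring, hone] at htwo
  have hprogeny := progenyGF_zero_eq_add hω hu hu1 x
  rw [progenyGF_one hω hu, show x - 1 - 1 = x - 2 by ring] at hprogeny
  have hw1 : stepWeight u x (x - 1) = u x 0 := by simp [stepWeight]
  have hw2 : stepWeight u x (x - 2) = u x 1 * u (x - 1) 2 := by simp [stepWeight]
  have hw3 : stepWeight u x (x + 1) = 1 := by
    rw [stepWeight, if_neg (by omega), if_neg (by omega), if_neg (by omega), one_mul, one_mul]
  simp only [integral_stepMeasure, Complex.real_smul, hw1, hw2, hw3, hleft x hx, hone, htwo]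
  linear_combination -(∏ j ∈ Finset.Ico (x + 1) n, progenyGF ω u j 0) * hprogeny

theorem integral_prod_pow_jumpCount (hω : ∀ x, 0 < prob (ω x) 1) {n : ℤ} (hn : 0 < n)
    (hhit : ∀ᵐ X ∂quenchedLaw ω, ∃ t, HitBy n t X) {S : Finset ℤ} (huS : ∀ i ∉ S, u i = 1)
    (hu : ∀ i < 0, u i = 1) (hu1 : ∀ i σ, ‖u i σ‖ ≤ 1) :
    ∫ X, ∏ i ∈ S, ∏ σ, u i σ ^ jumpCount n i X σ ∂quenchedLaw ω
      = ∏ j ∈ Finset.Ico 0 n, progenyGF ω u j 0 :=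
  integral_eq_of_harmonic (V := fun x => ∏ j ∈ Finset.Ico x n, progenyGF ω u j 0) hn hhit
    (norm_stepWeight_le_one hu1)
    (fun x => by
      rw [norm_prod]
      exact Finset.prod_le_one (fun _ _ => norm_nonneg _) fun j _ => norm_progenyGF_le_one hu1 j 0)
    (by simp) (fun _ hx => integral_stepWeight_mul_prod_progenyGF hω hu hu1 hx)
    fun _ hX _ hT => hT.prod_pow_jumpCount hX hn huS

theorem prod_Ico_zero_eq_prod_range_sub {M : Type*} [CommMonoid M] (f : ℤ → M) (n : ℕ) :
    ∏ j ∈ Finset.Ico (0 : ℤ) n, f j = ∏ k ∈ Finset.range n, f (n - 1 - k) := by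
  symm
  refine Finset.prod_nbij (fun k => (n : ℤ) - 1 - k) (fun k hk => ?_) (fun k _ l _ h => ?_)
    (fun j hj => ?_) fun _ _ => rfl
  · simp only [Finset.mem_Ico, Finset.mem_range] at hk ⊢
    omega
  · simpa using h
  · simp only [Finset.coe_Ico, Set.mem_Ico, Finset.coe_range, Set.mem_image, Set.mem_Iio] at hj ⊢
    exact ⟨((n : ℤ) - 1 - j).toNat, by omega, by omega⟩

theorem integral_prod_pow_branchingLaw (hω : ∀ x, 0 < prob (ω x) 1) (n : ℕ)
    (hu : ∀ i < 0, u i = 1) (hu1 : ∀ i σ, ‖u i σ‖ ≤ 1) :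
    ∫ Z, ∏ m : Fin (n + 1), ∏ σ, u (n - (m : ℕ)) σ ^ Z m σ
        ∂(branchingLaw fun m => offspringLaw (ω ((n : ℤ) - 1 - m)))
      = ∏ j ∈ Finset.Ico (0 : ℤ) n, progenyGF ω u j 0 := by
  set q : ℕ → Fin 3 → PMF (Fin 3 → ℕ) := fun m => offspringLaw (ω ((n : ℤ) - 1 - m))
  have hF := norm_progenyGF_le_one (ω := ω) hu1
  have hoffspring : ∀ m τ, ∫ v, ∏ σ, (u (n - (m + 1 : ℕ)) σ
        * progenyGF ω u (n - 1 - (m + 1 : ℕ)) σ) ^ v σ ∂(q m τ).toMeasure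
      = progenyGF ω u (n - 1 - m) τ := fun m τ => by
    rw [show (n : ℤ) - (m + 1 : ℕ) = n - 1 - m by push_cast; ring,
      show (n : ℤ) - 1 - (m + 1 : ℕ) = n - 1 - m - 1 by push_cast; ring,
      integral_offspringLaw (hω _) τ fun σ => norm_mul_le_one (hu1 _ σ) (hF _ σ),
      ← progenyGF_eq hω hu]
  have hgf := integral_prod_pow_generation q (s := fun m => u (n - m))
    (Φ := fun m => progenyGF ω u (n - 1 - m)) (fun m σ => hu1 _ σ) (fun m σ => hF _ σ) hoffspring
    n
  simp only [progenyGF_of_neg (show (n : ℤ) - 1 - n < 0 by omega), Pi.one_apply, one_pow,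
    Finset.prod_const_one, mul_one] at hgf
  have hmeas : Measurable fun Z : ℕ → Fin 3 → ℕ =>
      ∏ m : Fin (n + 1), ∏ σ, u (n - (m : ℕ)) σ ^ Z m σ := by fun_prop
  rw [prod_Ico_zero_eq_prod_range_sub, ← hgf]
  exact integral_map measurable_generation.aemeasurable hmeas.aestronglyMeasurable

end ProgenyGF

/-! ### Laws of count vectors are determined by their generating functions -/

theorem ext_of_integral_prod_pow {ι : Type*} [Fintype ι] {P Q : Measure (ι → ℕ)}
    [IsFiniteMeasure P] [IsFiniteMeasure Q]
    (h : ∀ z : ι → ℂ, (∀ i, ‖z i‖ = 1) → ∫ x, ∏ i, z i ^ x i ∂P = ∫ x, ∏ i, z i ^ x i ∂Q) :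
    P = Q := by
  let E : (ι → ℕ) → EuclideanSpace ℝ ι := fun x => WithLp.toLp 2 fun i => (x i : ℝ)
  have hE : Measurable E := measurable_of_countable E
  have hembed : MeasurableEmbedding E :=
    ⟨fun x y hxy => funext fun i => by simpa [E] using congrArg (fun v => v i) hxy, hE,
      fun s _ => (s.to_countable.image E).measurableSet⟩
  have hexp : ∀ (t : EuclideanSpace ℝ ι) (x : ι → ℕ),
      Complex.exp (inner ℝ (E x) t * Complex.I) = ∏ i, Complex.exp (t i * Complex.I) ^ x i :=
    fun t x => by
      simp only [← Complex.exp_nat_mul, ← Complex.exp_sum, PiLp.inner_apply, Complex.ofReal_sum,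
        Finset.sum_mul]
      refine congrArg Complex.exp (Finset.sum_congr rfl fun i _ => ?_)
      simp only [E, RCLike.inner_apply, conj_trivial, Complex.ofReal_mul, Complex.ofReal_natCast]
      ring
  have hmap : P.map E = Q.map E := Measure.ext_of_charFun <| funext fun t => by
    rw [charFun_apply, charFun_apply, integral_map hE.aemeasurable (by fun_prop),
      integral_map hE.aemeasurable (by fun_prop)]
    simp_rw [hexp]
    exact h _ fun i => Complex.norm_exp_ofReal_mul_I _
  rw [← hembed.comap_map P, hmap, hembed.comap_map]

theorem ext_of_integral_prod_prod_pow {ι κ : Type*} [Fintype ι] [Fintype κ]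
    {P Q : Measure (ι → κ → ℕ)} [IsFiniteMeasure P] [IsFiniteMeasure Q]
    (h : ∀ z : ι → κ → ℂ, (∀ i k, ‖z i k‖ = 1) →
      ∫ x, ∏ i, ∏ k, z i k ^ x i k ∂P = ∫ x, ∏ i, ∏ k, z i k ^ x i k ∂Q) : P = Q := by
  let e := (MeasurableEquiv.curry ι κ ℕ).symm
  suffices P.map e = Q.map e from e.map_measurableEquiv_injective this
  refine ext_of_integral_prod_pow fun z hz => ?_
  simp only [integral_map_equiv, Fintype.prod_prod_type]
  exact h (Function.curry z) fun i k => hz (i, k)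

theorem identDistrib_jumpCount_branchingLaw {ω : Env} (hω : ∀ x, 0 < prob (ω x) 1) {n : ℕ}
    (hn : 0 < n) (hhit : ∀ᵐ X ∂quenchedLaw ω, ∃ t, HitBy n t X) :
    IdentDistrib (fun X (m : Fin (n + 1)) => jumpCount n (n - (m : ℕ)) X)
      (fun Z (m : Fin (n + 1)) => Z m) (quenchedLaw ω)
      (branchingLaw fun m => offspringLaw (ω ((n : ℤ) - 1 - m))) := by
  have hn' : (0 : ℤ) < n := by exact_mod_cast hn
  have hX : AEMeasurable (fun X (m : Fin (n + 1)) => jumpCount n (n - (m : ℕ)) X)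
      (quenchedLaw ω) := aemeasurable_pi_iff.2 fun m => aemeasurable_jumpCount hn' hhit _
  have hZ : Measurable fun (Z : ℕ → Fin 3 → ℕ) (m : Fin (n + 1)) => Z m := by fun_prop
  refine ⟨hX, hZ.aemeasurable, ext_of_integral_prod_prod_pow fun z hz => ?_⟩
  let site : Fin (n + 1) ↪ ℤ := ⟨fun m => n - (m : ℕ), fun _ _ h => Fin.ext (by simpa using h)⟩
  have hsite : ∀ m, site m = n - (m : ℕ) := fun _ => rfl
  let u : ℤ → Fin 3 → ℂ := Function.extend site z 1
  have husite : ∀ m : Fin (n + 1), u (n - (m : ℕ)) = z m := fun m =>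
    site.injective.extend_apply z 1 m
  have huS : ∀ i ∉ Finset.univ.map site, u i = 1 := fun i hi =>
    Function.extend_apply' z (1 : ℤ → Fin 3 → ℂ) i (by simpa using hi)
  have hu : ∀ i < 0, u i = 1 := fun i hi => huS i fun h => by
    obtain ⟨m, -, rfl⟩ := Finset.mem_map.1 h
    rw [hsite] at hi
    omega
  have hu1 : ∀ i σ, ‖u i σ‖ ≤ 1 := fun i σ => by
    by_cases hi : i ∈ Finset.univ.map site
    · obtain ⟨m, -, rfl⟩ := Finset.mem_map.1 hi
      exact (congrArg (fun v => ‖v σ‖) (husite m)).trans_le (hz m σ).le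
    · simp [huS i hi]
  have hjump := integral_prod_pow_jumpCount hω hn' hhit huS hu hu1
  have hbranching := integral_prod_pow_branchingLaw hω n hu hu1
  rw [integral_map hX (measurable_of_countable _).aestronglyMeasurable,
    integral_map hZ.aemeasurable (measurable_of_countable _).aestronglyMeasurable]
  simp only [Finset.prod_map, hsite, husite] at hjump hbranching
  exact hjump.trans hbranching.symm

end RWRE

theorem mainTheorem4_general (ν : Measure StepLaw) [IsProbabilityMeasure ν]
    (hpos : ∀ᵐ p ∂ν, 0 < prob p 1) (hint : Integrable (fun p => Real.log (prob p 1)) ν)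
    (hγ : topLyapunov ν < 0) :
    ∀ᵐ ω ∂envLaw ν,
      (∀ (i : ℤ) (a b : ℕ),
        offspringLaw (ω i) 0 ![a, b, 0]
            = ENNReal.ofReal (((a + b)! : ℝ) / ((a ! : ℝ) * (b ! : ℝ))
              * prob (ω i) (-1) ^ a * prob (ω i) (-2) ^ b * prob (ω i) 1) ∧
        offspringLaw (ω i) 1 ![a, b, 1]
            = ENNReal.ofReal (((a + b)! : ℝ) / ((a ! : ℝ) * (b ! : ℝ))
              * prob (ω i) (-1) ^ a * prob (ω i) (-2) ^ b * prob (ω i) 1) ∧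
        offspringLaw (ω i) 2 ![a, b, 0]
            = ENNReal.ofReal (((a + b)! : ℝ) / ((a ! : ℝ) * (b ! : ℝ))
              * prob (ω i) (-1) ^ a * prob (ω i) (-2) ^ b * prob (ω i) 1)) ∧
      ∀ n : ℕ, 0 < n →
        (∀ᵐ X ∂quenchedLaw ω, jumpCount n n X = 0) ∧
        IdentDistrib
          (fun (X : ℕ → ℤ) (m : Fin (n + 1)) => jumpCount n ((n : ℤ) - (m : ℕ)) X)
          (fun (Z : ℕ → Fin 3 → ℕ) (m : Fin (n + 1)) => Z m)
          (quenchedLaw ω)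
          (branchingLaw fun m => offspringLaw (ω ((n : ℤ) - 1 - m))) ∧
        ∀ᵐ X ∂quenchedLaw ω, ∃ s : ℕ,
          HasSum (fun k : Set.Iic ((n : ℤ) - 1) => jumpCount n k X ⬝ᵥ ![2, 1, 2]) s ∧
          hittingTime n X = n + s := by
  filter_upwards [ae_prob_pos ν hpos, ae_exists_isMeanPassageTime ν hpos hint hγ]
    with ω hω ⟨h, hh⟩
  refine ⟨fun i a b => ⟨offspringLaw_apply (hω i) 0 a b, offspringLaw_apply (hω i) 1 a b,
    offspringLaw_apply (hω i) 2 a b⟩, fun n hn => ?_⟩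
  have hn' : (0 : ℤ) < n := by exact_mod_cast hn
  have hhit := hh.ae_exists_hitBy hn'
  have hfirst : ∀ᵐ X ∂quenchedLaw ω, IsWalk X ∧ ∃ T, FirstHit n T X :=
    (ae_isWalk ω).and (hhit.mono fun _ => exists_firstHit)
  refine ⟨?_, identDistrib_jumpCount_branchingLaw hω hn hhit, ?_⟩
  · filter_upwards [hfirst] with X ⟨hX, T, hT⟩
    exact hT.jumpCount_self hX hn'
  · filter_upwards [hfirst] with X ⟨hX, T, hT⟩
    exact hT.exists_hasSum_jumpCount hX hn

theorem mainTheorem4 {d : ℕ} {Θ : Set (EuclideanSpace ℝ (Fin d))} (hΘ : IsCompact Θ)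
    (ν : Θ → Measure StepLaw) [∀ θ, IsProbabilityMeasure (ν θ)]
    (hlog : UniformLogMoment ν) (hγ : ∀ θ, topLyapunov (ν θ) < 0) (θ : Θ) :
    ∀ᵐ ω ∂envLaw (ν θ),
      (∀ (i : ℤ) (a b : ℕ),
        offspringLaw (ω i) 0 ![a, b, 0]
            = ENNReal.ofReal (((a + b)! : ℝ) / ((a ! : ℝ) * (b ! : ℝ))
              * prob (ω i) (-1) ^ a * prob (ω i) (-2) ^ b * prob (ω i) 1) ∧
        offspringLaw (ω i) 1 ![a, b, 1]
            = ENNReal.ofReal (((a + b)! : ℝ) / ((a ! : ℝ) * (b ! : ℝ))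
              * prob (ω i) (-1) ^ a * prob (ω i) (-2) ^ b * prob (ω i) 1) ∧
        offspringLaw (ω i) 2 ![a, b, 0]
            = ENNReal.ofReal (((a + b)! : ℝ) / ((a ! : ℝ) * (b ! : ℝ))
              * prob (ω i) (-1) ^ a * prob (ω i) (-2) ^ b * prob (ω i) 1)) ∧
      ∀ n : ℕ, 0 < n →
        (∀ᵐ X ∂quenchedLaw ω, jumpCount n n X = 0) ∧
        IdentDistrib
          (fun (X : ℕ → ℤ) (m : Fin (n + 1)) => jumpCount n ((n : ℤ) - (m : ℕ)) X)
          (fun (Z : ℕ → Fin 3 → ℕ) (m : Fin (n + 1)) => Z m)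
          (quenchedLaw ω)
          (branchingLaw fun m => offspringLaw (ω ((n : ℤ) - 1 - m))) ∧
        ∀ᵐ X ∂quenchedLaw ω, ∃ s : ℕ,
          HasSum (fun k : Set.Iic ((n : ℤ) - 1) => jumpCount n k X ⬝ᵥ ![2, 1, 2]) s ∧
          hittingTime n X = n + s :=
  mainTheorem4_general (ν θ) ((hlog 1 (by simp)).1 θ).1 ((hlog 1 (by simp)).1 θ).2 (hγ θ)
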